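/- Let $0<\beta_2\le 1\le\beta_1<\infty$ and consider the system $$\partial_t\omega+u\,\partial_x\omega=\frac{\rho}{x},\qquad \partial_t\rho+u\,\partial_x\rho=0,$$ $$u(x,t)=x\int_{\min(\beta_2x,1)}^{\min(\beta_1x,1)}\frac{\omega(y,t)}{y}\,dy-x\int_{\min(\beta_1x,1)}^{1}\frac{\omega(y,t)}{y}\,dy .$$ For an integer $n\ge1$ let $K^n$ be the set of $C^n$ functions compactly supported in $(0,1)$, with $\|f\|_{K^n}=\|f\|_{C^n}+(\min\operatorname{supp} f)^{-1}$ (the last term being $0$ for $f=0$). Write $f\in C([0,T),K^n)$ if $f(t)\in K^n$ for all $t\in[0,T)$, $t\mapsto f(t)$ is continuous in the $C^n$ norm, and $\|f(t)\|_{K^n}$ is bounded on compact subintervals of $[0,T)$. Let $0<T<\infty$ and let $(\omega,\rho)\in C([0,T),K^n)\times C([0,T),K^n)$ be a solution of the system on $[0,T)$. Put $\delta(t)=\min\big(\operatorname{supp}\omega(\cdot,t)\cup\operatorname{supp}\rho(\cdot,t)\big)$, with $\min\emptyset=+\infty$; all $L^\infty$ norms are over $(0,1)$. Consider the conditions (a)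 the solution can be continued past $T$, i.e. for some $T'>T$ there is a solution in $C([0,T'),K^n)\times C([0,T'),K^n)$ that coincides with $(\omega,\rho)$ on $[0,T)$; (b) $\int_0^T\|\partial_xu(\cdot,t)\|_{L^\infty}\,dt<\infty$; (c) $\int_0^T\|\partial_x\rho(\cdot,t)\|_{L^\infty}\,dt<\infty$; (d) $\int_0^T\|\omega(\cdot,t)\|_{L^\infty}\,dt<\infty$; (e) $\liminf_{t\to T^-}\delta(t)>0$. If the supports stay away from the cut-off point $x=1$, that is, if there is $b<1$ with $\operatorname{supp}\omega(\cdot,t)\cup\operatorname{supp}\rho(\cdot,t)\subset(0,b]$ for all $t\in[0,T)$, then (a), (b), (c), (d) and (e) are equivalent. Moreover, (b), (c), (d) and (e) are equivalent without this assumption, and (a) implies that the assumption holds. -/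

import Mathlib

open Set Filter MeasureTheory
open scoped Topology ENNReal

namespace HouLuoModel

/-- The smallest point of the (closed) support of a function supported in `(0,1)`, as an extended
nonnegative number; it is `+∞` if the support is empty. -/
noncomputable def minSupp (f : ℝ → ℝ) : ℝ≥0∞ :=
  ⨅ x ∈ tsupport f, ENNReal.ofReal x

/-- The `C^n` norm on `(0,1)`: the sum of the suprema of the derivatives of orders `0, …, n`. -/
noncomputable def cNorm (n : ℕ) (f : ℝ → ℝ) : ℝ≥0∞ :=
  ∑ k ∈ Finset.range (n + 1), ⨆ x ∈ Ioo (0 : ℝ) 1, ‖iteratedDeriv k f x‖ₑ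

/-- The quantity `‖f‖_{K^n} = ‖f‖_{C^n} + (min supp f)⁻¹` (the last term is `0` for `f = 0`). -/
noncomputable def kNorm (n : ℕ) (f : ℝ → ℝ) : ℝ≥0∞ :=
  cNorm n f + (minSupp f)⁻¹

/-- `K^n`: the `C^n` functions that are compactly supported in `(0,1)`, extended by `0` to the
whole line. -/
def MemK (n : ℕ) (f : ℝ → ℝ) : Prop :=
  ContDiff ℝ n f ∧ HasCompactSupport f ∧ tsupport f ⊆ Ioo 0 1

/-- The class `C([0,T), K^n)`.  Since `‖·‖_{K^n}` is not a norm (it is not homogeneous, and the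
difference of two close functions need not have small `K^n` size), membership means: every
`f t` lies in `K^n`, the map `t ↦ f t` is continuous for the `C^n` norm, and `‖f t‖_{K^n}` is
bounded on every compact subinterval of `[0,T)`. -/
structure ContK (n : ℕ) (T : ℝ) (f : ℝ → ℝ → ℝ) : Prop where
  mem : ∀ t ∈ Ico 0 T, MemK n (f t)
  cont : ∀ t ∈ Ico 0 T,
    Tendsto (fun s => cNorm n (fun x => f s x - f t x)) (𝓝[Ico 0 T] t) (𝓝 0)
  bdd : ∀ S < T, (⨆ t ∈ Icc 0 S, kNorm n (f t)) < ∞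

/-- The velocity given by the Biot-Savart law
`u(x) = x ∫_{min(β₂x,1)}^{min(β₁x,1)} w(y)/y dy - x ∫_{min(β₁x,1)}^1 w(y)/y dy`. -/
noncomputable def velocity (β₁ β₂ : ℝ) (w : ℝ → ℝ) (x : ℝ) : ℝ :=
  x * (∫ y in (min (β₂ * x) 1)..(min (β₁ * x) 1), w y / y)
    - x * (∫ y in (min (β₁ * x) 1)..1, w y / y)

/-- `(ω, ρ)` is a solution of the system on `[0,T)` in `C([0,T), K^n) × C([0,T), K^n)`:
`∂ₜω + u ∂ₓω = ρ/x` and `∂ₜρ + u ∂ₓρ = 0` hold pointwise (with a one-sided time derivative at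
`t = 0`). The functions are written `ω t x`, `ρ t x`. -/
structure IsSolution (β₁ β₂ : ℝ) (n : ℕ) (T : ℝ) (ω ρ : ℝ → ℝ → ℝ) : Prop where
  contK_omega : ContK n T ω
  contK_rho : ContK n T ρ
  eq_omega : ∀ t ∈ Ico 0 T, ∀ x ∈ Ioo (0 : ℝ) 1,
    HasDerivWithinAt (fun s => ω s x)
      (ρ t x / x - velocity β₁ β₂ (ω t) x * deriv (ω t) x) (Ico 0 T) t
  eq_rho : ∀ t ∈ Ico 0 T, ∀ x ∈ Ioo (0 : ℝ) 1,
    HasDerivWithinAt (fun s => ρ s x)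
      (- (velocity β₁ β₂ (ω t) x * deriv (ρ t) x)) (Ico 0 T) t

/-- The solution `(ω, ρ)` on `[0,T)` can be continued past `T`: it is the restriction of a
solution of the same class on a longer interval `[0,T')`. -/
def CanBeContinued (β₁ β₂ : ℝ) (n : ℕ) (T : ℝ) (ω ρ : ℝ → ℝ → ℝ) : Prop :=
  ∃ T' > T, ∃ ω' ρ' : ℝ → ℝ → ℝ, IsSolution β₁ β₂ n T' ω' ρ' ∧
    ∀ t ∈ Ico 0 T, ω' t = ω t ∧ ρ' t = ρ t

/-- The `L^∞` norm on `(0,1)`. -/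
noncomputable def supNorm (f : ℝ → ℝ) : ℝ≥0∞ :=
  eLpNorm f ∞ (volume.restrict (Ioo (0 : ℝ) 1))

/-- `δ(t)`: the smallest point of `supp ω(t) ∪ supp ρ(t)` (`+∞` if both are empty). -/
noncomputable def delta (ω ρ : ℝ → ℝ → ℝ) (t : ℝ) : ℝ≥0∞ :=
  ⨅ x ∈ tsupport (ω t) ∪ tsupport (ρ t), ENNReal.ofReal x

/-- Up to time `T` the supports stay at a positive distance from the artificial cut-off
point `x = 1`. -/
def StaysBelowOne (T : ℝ) (ω ρ : ℝ → ℝ → ℝ) : Prop :=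
  ∃ b < (1 : ℝ), ∀ t ∈ Ico 0 T, tsupport (ω t) ∪ tsupport (ρ t) ⊆ Iic b

end HouLuoModel

/-! While the supports stay in [c, 1) with c > 0 the system is not singular: 1/x may be replaced by
a smooth bounded χ, and the velocity, an integral of χω, is one derivative smoother than ω.
Everything then reduces to the ODE X' = u(t, X). Along its orbits ρ is constant and ω equals ω₀ + ρ₀
∫ χ(X) ds (`IsSolution.chars_of_velocity`), so X(t, ·), an increasing homeomorphism, carries the
union of the supports, and the least point of that union moves along a single orbit q(t). Condition
(e) says that this orbit stays bounded away from 0.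

Three estimates lead to (e). Since u vanishes at x = 0, |q'/q| ≤ ‖∂ₓu‖, and (b) bounds log q. The
integrals of |ω|/y over parts of [q, 1] are at most ‖ω‖ log(1/q), so |q'| ≤ 3‖ω‖ q log(1/q), and (d)
bounds log log(1/q); this is an Osgood argument. Since ρ vanishes at x = 0, |ρ/x| ≤ ‖∂ₓρ‖, so (c)
bounds ω and gives (d). Conversely, under (e) the Lagrangian formula bounds ω, hence the Lipschitz
constant of u, hence ∂ₓρ (`IsSolution.lintegrals_of_suppBddBelow`).

For continuation no limit of the solution at T is taken. The truncated system is solved on [0, T +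
1] from the data at time 0, by a contraction in an exponentially weighted norm
(`Cutoff.exists_fixedPoint`), and uniqueness identifies the result with the given solution on [0, T)
(`Cutoff.eq_of_fixedPoint`). The two extreme orbits are continuous through T, so for a short time
after T the supports remain where the truncation is inactive, and the truncated solution solves the
original system (`Cutoff.isSolution_of_fixedPoint`). Confinement below 1 has to be assumed because u
need not vanish at x = 1. It is also necessary: the greatest point of the support of a longer
solution follows a continuous orbit in (0, 1) over the compact interval [0, T]. -/

namespace HouLuoModel

/-! ### Calculus of functions with jointly continuous space derivatives -/

/-- `JointC k f`: the derivatives of `f t x` in `x` of orders `0, …, k` exist and are jointly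
continuous in `(t, x)`. -/
def JointC : ℕ → (ℝ → ℝ → ℝ) → Prop
  | 0, f => Continuous fun p : ℝ × ℝ => f p.1 p.2
  | k + 1, f => (Continuous fun p : ℝ × ℝ => f p.1 p.2) ∧
      ∃ f' : ℝ → ℝ → ℝ, (∀ t x, HasDerivAt (f t) (f' t x) x) ∧ JointC k f'

namespace JointC

variable {k : ℕ} {f g : ℝ → ℝ → ℝ}

lemma continuous (hf : JointC k f) : Continuous fun p : ℝ × ℝ => f p.1 p.2 := by
  cases k with
  | zero => exact hf
  | succ k => exact hf.1

lemma of_succ (hf : JointC (k + 1) f) : JointC k f := by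
  induction k generalizing f with
  | zero => exact hf.1
  | succ k ih =>
    obtain ⟨hc, f', hf', hk⟩ := hf
    exact ⟨hc, f', hf', ih hk⟩

lemma const (k : ℕ) (c : ℝ) : JointC k (fun _ _ => c) := by
  induction k generalizing c with
  | zero => exact continuous_const
  | succ k ih => exact ⟨continuous_const, fun _ _ => 0, fun _ x => hasDerivAt_const x c, ih 0⟩

lemma id (k : ℕ) : JointC k (fun _ x => x) := by
  cases k with
  | zero => exact continuous_snd
  | succ k => exact ⟨continuous_snd, fun _ _ => 1, fun _ x => hasDerivAt_id x, const k 1⟩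

lemma of_contDiff {h : ℝ → ℝ} (hh : ContDiff ℝ k h) : JointC k (fun _ x => h x) := by
  induction k generalizing h with
  | zero => exact hh.continuous.comp continuous_snd
  | succ k ih =>
    have h1 := contDiff_succ_iff_deriv.1 (by exact_mod_cast hh : ContDiff ℝ ((k : ℕ∞) + 1) h)
    exact ⟨hh.continuous.comp continuous_snd, fun _ => deriv h,
      fun _ x => (h1.1 x).hasDerivAt, ih (by exact_mod_cast h1.2.2)⟩

lemma add (hf : JointC k f) (hg : JointC k g) : JointC k (fun t x => f t x + g t x) := by
  induction k generalizing f g with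
  | zero => exact Continuous.add hf hg
  | succ k ih =>
    obtain ⟨hfc, f', hf', hfk⟩ := hf
    obtain ⟨hgc, g', hg', hgk⟩ := hg
    exact ⟨hfc.add hgc, fun t x => f' t x + g' t x, fun t x => (hf' t x).add (hg' t x), ih hfk hgk⟩

lemma mul (hf : JointC k f) (hg : JointC k g) : JointC k (fun t x => f t x * g t x) := by
  induction k generalizing f g with
  | zero => exact Continuous.mul hf hg
  | succ k ih =>
    have hf0 := hf.of_succ
    have hg0 := hg.of_succ
    obtain ⟨hfc, f', hf', hfk⟩ := hf
    obtain ⟨hgc, g', hg', hgk⟩ := hg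
    exact ⟨hfc.mul hgc, fun t x => f' t x * g t x + f t x * g' t x,
      fun t x => (hf' t x).mul (hg' t x), (ih hfk hg0).add (ih hf0 hgk)⟩

lemma const_mul (c : ℝ) (hf : JointC k f) : JointC k (fun t x => c * f t x) :=
  (const k c).mul hf

lemma neg (hf : JointC k f) : JointC k (fun t x => -f t x) := by
  simpa using hf.const_mul (-1)

lemma sub (hf : JointC k f) (hg : JointC k g) : JointC k (fun t x => f t x - g t x) := by
  simpa [sub_eq_add_neg] using hf.add hg.neg

lemma comp (hf : JointC k f) (hg : JointC k g) : JointC k (fun t x => f t (g t x)) := by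
  induction k generalizing f g with
  | zero =>
    have h1 : Continuous fun p : ℝ × ℝ => f p.1 p.2 := hf
    exact h1.comp (continuous_fst.prodMk hg)
  | succ k ih =>
    have hg0 := hg.of_succ
    obtain ⟨hfc, f', hf', hfk⟩ := hf
    obtain ⟨hgc, g', hg', hgk⟩ := hg
    exact ⟨hfc.comp (continuous_fst.prodMk hgc), fun t x => f' t (g t x) * g' t x,
      fun t x => (hf' t (g t x)).comp x (hg' t x), (ih hfk hg0).mul hgk⟩

lemma contDiff_comp {h : ℝ → ℝ} (hh : ContDiff ℝ k h) (hg : JointC k g) :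
    JointC k (fun t x => h (g t x)) :=
  (of_contDiff hh).comp hg

lemma comp_time {τ : ℝ → ℝ} (hτ : Continuous τ) (hf : JointC k f) :
    JointC k (fun t x => f (τ t) x) := by
  induction k generalizing f with
  | zero =>
    have h1 : Continuous fun p : ℝ × ℝ => f p.1 p.2 := hf
    exact h1.comp ((hτ.comp continuous_fst).prodMk continuous_snd)
  | succ k ih =>
    obtain ⟨hfc, f', hf', hfk⟩ := hf
    exact ⟨hfc.comp ((hτ.comp continuous_fst).prodMk continuous_snd), fun t x => f' (τ t) x,
      fun t x => hf' (τ t) x, ih hfk⟩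

lemma contDiff (hf : JointC k f) (t : ℝ) : ContDiff ℝ k (f t) := by
  induction k generalizing f with
  | zero => exact_mod_cast contDiff_zero.2 (hf.continuous.comp (Continuous.prodMk_right t))
  | succ k ih =>
    obtain ⟨hfc, f', hf', hfk⟩ := hf
    have : deriv (f t) = f' t := funext fun x => (hf' t x).deriv
    have h1 : ContDiff ℝ ((k : ℕ∞) + 1) (f t) := by
      refine contDiff_succ_iff_deriv.2 ⟨fun x => (hf' t x).differentiableAt, by simp, ?_⟩
      rw [this]
      exact_mod_cast ih hfk
    exact_mod_cast h1

lemma continuous_iteratedDeriv {j : ℕ} (hj : j ≤ k) (hf : JointC k f) :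
    Continuous fun p : ℝ × ℝ => iteratedDeriv j (f p.1) p.2 := by
  induction j generalizing f k with
  | zero => simpa using hf.continuous
  | succ j ih =>
    obtain ⟨k, rfl⟩ : ∃ m, k = m + 1 := ⟨k - 1, by omega⟩
    obtain ⟨hfc, f', hf', hfk⟩ := hf
    have : ∀ t, deriv (f t) = f' t := fun t => funext fun x => (hf' t x).deriv
    simp_rw [iteratedDeriv_succ', this]
    exact ih (by omega) hfk

end JointC

/-! ### Time integrals and differentiation along curves -/

/-- Differentiation under an interval integral, for a jointly continuous derivative. -/
lemma hasDerivAt_intervalIntegral_of_continuous {f f' : ℝ → ℝ → ℝ}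
    (hf : Continuous fun p : ℝ × ℝ => f p.1 p.2) (hf' : Continuous fun p : ℝ × ℝ => f' p.1 p.2)
    (h : ∀ t x, HasDerivAt (f t) (f' t x) x) (a b x : ℝ) :
    HasDerivAt (fun y => ∫ s in a..b, f s y) (∫ s in a..b, f' s x) x := by
  obtain ⟨C, hC⟩ := ((isCompact_uIcc (a := a) (b := b)).prod
    (isCompact_closedBall x 1)).exists_bound_of_continuousOn hf'.continuousOn
  refine (intervalIntegral.hasDerivAt_integral_of_dominated_loc_of_deriv_le
    (F := fun y s => f s y) (F' := fun y s => f' s y) (bound := fun _ => C)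
    (Metric.closedBall_mem_nhds x one_pos) ?_ ?_ ?_ ?_ ?_ ?_).2
  · exact Eventually.of_forall fun y =>
      (hf.comp (continuous_id.prodMk continuous_const)).aestronglyMeasurable
  · exact (hf.comp (continuous_id.prodMk continuous_const)).intervalIntegrable _ _
  · exact (hf'.comp (continuous_id.prodMk continuous_const)).aestronglyMeasurable
  · exact Eventually.of_forall fun s hs y hy => hC (s, y) ⟨uIoc_subset_uIcc hs, hy⟩
  · exact continuous_const.intervalIntegrable _ _
  · exact Eventually.of_forall fun s _ y _ => h s y

lemma continuous_primitive_param {f : ℝ → ℝ → ℝ} (hf : Continuous fun p : ℝ × ℝ => f p.1 p.2) :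
    Continuous fun p : ℝ × ℝ => ∫ s in (0 : ℝ)..p.1, f s p.2 := by
  refine intervalIntegral.continuous_parametric_intervalIntegral_of_continuous
    (f := fun (p : ℝ × ℝ) s => f s p.2) ?_ continuous_fst
  exact hf.comp (continuous_snd.prodMk (continuous_snd.comp continuous_fst))

lemma JointC.integral {k : ℕ} {f : ℝ → ℝ → ℝ} (hf : JointC k f) :
    JointC k (fun t x => ∫ s in (0 : ℝ)..t, f s x) := by
  induction k generalizing f with
  | zero => exact continuous_primitive_param hf
  | succ k ih =>
    obtain ⟨hfc, f', hf', hfk⟩ := hf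
    exact ⟨continuous_primitive_param hfc, fun t x => ∫ s in (0 : ℝ)..t, f' s x,
      fun t x => hasDerivAt_intervalIntegral_of_continuous hfc hfk.continuous hf' 0 t x, ih hfk⟩

/-- The chain rule along a curve, with the variation at a frozen point taken out. -/
lemma hasDerivWithinAt_sub_frozen {f f' : ℝ → ℝ → ℝ} {I : Set ℝ} {γ : ℝ → ℝ} {t₀ v : ℝ}
    (hf : ∀ t ∈ I, ∀ x, HasDerivAt (f t) (f' t x) x)
    (hf' : ContinuousWithinAt (fun p : ℝ × ℝ => f' p.1 p.2) (I ×ˢ univ) (t₀, γ t₀))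
    (hγ : HasDerivWithinAt γ v I t₀) :
    HasDerivWithinAt (fun t => f t (γ t) - f t (γ t₀)) (f' t₀ (γ t₀) * v) I t₀ := by
  -- The mean value theorem is applied in x at each fixed t. No time derivative of f enters, so the
  -- time derivative at the frozen point can be added or subtracted afterwards, whichever is known.
  have key : ∀ t ∈ I, ∃ η, |η - γ t₀| ≤ |γ t - γ t₀| ∧
      f t (γ t) - f t (γ t₀) = f' t η * (γ t - γ t₀) := by
    intro t ht
    rcases lt_trichotomy (γ t) (γ t₀) with h | h | h
    · obtain ⟨c, hc, hc'⟩ := exists_hasDerivAt_eq_slope (f t) (f' t) h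
        (fun x _ => (hf t ht x).continuousAt.continuousWithinAt) (fun x _ => hf t ht x)
      refine ⟨c, ?_, ?_⟩
      · rw [abs_sub_comm, abs_sub_comm (γ t), abs_of_pos, abs_of_pos] <;> linarith [hc.1, hc.2]
      · rw [hc', ← neg_sub (γ t₀) (γ t), mul_neg, div_mul_cancel₀ _ (sub_ne_zero.2 h.ne')]
        ring
    · exact ⟨γ t₀, by simp, by rw [h]; simp⟩
    · obtain ⟨c, hc, hc'⟩ := exists_hasDerivAt_eq_slope (f t) (f' t) h
        (fun x _ => (hf t ht x).continuousAt.continuousWithinAt) (fun x _ => hf t ht x)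
      refine ⟨c, ?_, ?_⟩
      · rw [abs_of_pos, abs_of_pos] <;> linarith [hc.1, hc.2]
      · rw [hc', div_mul_cancel₀ _ (sub_ne_zero.2 h.ne')]
  choose! η hη1 hη2 using key
  have hη : Tendsto η (𝓝[I] t₀) (𝓝 (γ t₀)) := by
    rw [tendsto_iff_dist_tendsto_zero]
    have h1 : Tendsto (fun t => |γ t - γ t₀|) (𝓝[I] t₀) (𝓝 0) := by
      have := (hγ.continuousWithinAt.sub (continuousWithinAt_const (b := γ t₀))).abs
      simpa [ContinuousWithinAt] using this
    refine squeeze_zero' (Eventually.of_forall fun _ => dist_nonneg) ?_ h1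
    filter_upwards [self_mem_nhdsWithin] with t ht using hη1 t ht
  have hm : Tendsto (fun t => f' t (η t)) (𝓝[I] t₀) (𝓝 (f' t₀ (γ t₀))) := by
    refine Tendsto.comp (f := fun t => (t, η t)) hf' ?_
    refine tendsto_nhdsWithin_iff.2 ⟨?_, ?_⟩
    · rw [nhds_prod_eq]
      exact (tendsto_id.mono_left nhdsWithin_le_nhds).prodMk hη
    · filter_upwards [self_mem_nhdsWithin] with t ht using ⟨ht, mem_univ _⟩
  rw [hasDerivWithinAt_iff_tendsto_slope] at hγ ⊢
  refine ((hm.mono_left (nhdsWithin_mono _ sdiff_subset)).mul hγ).congr' ?_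
  filter_upwards [self_mem_nhdsWithin] with t ht
  simp only [slope_def_field, sub_self, sub_zero, hη2 t ht.1]
  ring

/-- A function whose derivative is dominated by `F` varies by at most `∫ F`. -/
lemma abs_sub_le_toReal_lintegral {S T : ℝ} (hST : S ≤ T) {f f' : ℝ → ℝ} {F : ℝ → ℝ≥0∞}
    (hf : ∀ t ∈ Icc 0 S, HasDerivWithinAt f (f' t) (Icc 0 S) t) (hf' : ContinuousOn f' (Icc 0 S))
    (hF : ∀ t ∈ Icc 0 S, ‖f' t‖ₑ ≤ F t) (hfin : (∫⁻ t in Ioo 0 T, F t) < ∞) {t : ℝ}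
    (ht : t ∈ Icc 0 S) : |f t - f 0| ≤ (∫⁻ t in Ioo 0 T, F t).toReal := by
  have hsub : Icc 0 t ⊆ Icc 0 S := Icc_subset_Icc_right ht.2
  have hint : IntervalIntegrable f' volume 0 t := by
    refine ContinuousOn.intervalIntegrable ?_
    rw [uIcc_of_le ht.1]
    exact hf'.mono hsub
  have hftc : ∫ s in (0 : ℝ)..t, f' s = f t - f 0 := by
    refine intervalIntegral.integral_eq_sub_of_hasDerivAt_of_le ht.1 ?_ ?_ hint
    · exact fun s hs => ((hf s (hsub hs)).mono hsub).continuousWithinAt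
    · intro s hs
      exact (hf s (hsub (Ioo_subset_Icc_self hs))).hasDerivAt
        (Icc_mem_nhds hs.1 (hs.2.trans_le ht.2))
  rw [← hftc, intervalIntegral.integral_of_le ht.1, integral_Ioc_eq_integral_Ioo,
    ← Real.norm_eq_abs]
  refine (norm_integral_le_lintegral_norm _).trans (ENNReal.toReal_mono hfin.ne ?_)
  calc ∫⁻ s in Ioo 0 t, ENNReal.ofReal ‖f' s‖ ≤ ∫⁻ s in Ioo 0 t, F s := by
        refine setLIntegral_mono' measurableSet_Ioo fun s hs => ?_
        rw [ofReal_norm]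
        exact hF s (hsub (Ioo_subset_Icc_self hs))
    _ ≤ ∫⁻ s in Ioo 0 T, F s := lintegral_mono_set (Ioo_subset_Ioo_right (ht.2.trans hST))

end HouLuoModel

/-! ### Flow of a bounded Lipschitz velocity field -/

namespace HouLuoModel

/-- A bounded, jointly continuous velocity field that is Lipschitz in space, uniformly in time. -/
structure IsVelocity (L B : ℝ) (u : ℝ → ℝ → ℝ) : Prop where
  cont : Continuous fun p : ℝ × ℝ => u p.1 p.2
  bdd : ∀ t x, |u t x| ≤ B
  lip : ∀ t x y, |u t x - u t y| ≤ L * |x - y|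

namespace IsVelocity

variable {L B : ℝ} {u : ℝ → ℝ → ℝ}

lemma B_nonneg (hu : IsVelocity L B u) : 0 ≤ B := (abs_nonneg _).trans (hu.bdd 0 0)

lemma L_nonneg (hu : IsVelocity L B u) : 0 ≤ L := by
  have := (abs_nonneg _).trans (hu.lip 0 1 0)
  simpa using this

lemma lipschitzWith (hu : IsVelocity L B u) (t : ℝ) : LipschitzWith L.toNNReal (u t) := by
  refine LipschitzWith.of_dist_le_mul fun x y => ?_
  rw [Real.coe_toNNReal _ hu.L_nonneg, Real.dist_eq, Real.dist_eq]
  exact hu.lip t x y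

lemma exists_local (hu : IsVelocity L B u) (x : ℝ) (n : ℕ) :
    ∃ α : ℝ → ℝ, α 0 = x ∧ ∀ t ∈ Icc (-(n + 1 : ℝ)) (n + 1),
      HasDerivWithinAt α (u t (α t)) (Icc (-(n + 1 : ℝ)) (n + 1)) t := by
  have hn : (0 : ℝ) ≤ n + 1 := by positivity
  have h0 : (0 : ℝ) ∈ Icc (-(n + 1 : ℝ)) (n + 1) := ⟨by linarith, hn⟩
  -- In time n + 1 an orbit of speed at most B moves by at most B(n + 1); with this radius
  -- Picard-Lindelöf covers the whole time interval.
  have hpl : IsPicardLindelof u (⟨0, h0⟩ : Icc (-(n + 1 : ℝ)) (n + 1)) x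
      (B.toNNReal * (n + 1)) 0 B.toNNReal L.toNNReal :=
    { lipschitzOnWith := fun t _ => (hu.lipschitzWith t).lipschitzOnWith
      continuousOn := fun y _ => (hu.cont.comp (Continuous.prodMk_left y)).continuousOn
      norm_le := fun t _ y _ => by
        rw [Real.coe_toNNReal _ hu.B_nonneg]
        exact hu.bdd t y
      mul_max_le := by simp }
  simpa using hpl.exists_eq_forall_mem_Icc_hasDerivWithinAt₀

lemma exists_curve (hu : IsVelocity L B u) (x : ℝ) :
    ∃ α : ℝ → ℝ, α 0 = x ∧ ∀ t, HasDerivAt α (u t (α t)) t := by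
  choose α hα0 hα using hu.exists_local x
  have hd : ∀ n : ℕ, ∀ t ∈ Ioo (-(n + 1 : ℝ)) (n + 1), HasDerivAt (α n) (u t (α n t)) t :=
    fun n t ht => (hα n t (Ioo_subset_Icc_self ht)).hasDerivAt (Icc_mem_nhds ht.1 ht.2)
  have hcomp : ∀ n m : ℕ, n ≤ m → EqOn (α n) (α m) (Ioo (-(n + 1 : ℝ)) (n + 1)) := by
    intro n m hnm
    have hnm' : (n : ℝ) ≤ m := by exact_mod_cast hnm
    have hn : (0 : ℝ) < n + 1 := by positivity
    refine ODE_solution_unique_of_mem_Ioo (v := u) (s := fun _ => univ) (t₀ := 0)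
      (K := L.toNNReal) (fun t _ => (hu.lipschitzWith t).lipschitzOnWith)
      ⟨by linarith, hn⟩ (fun t ht => ⟨hd n t ht, mem_univ _⟩)
      (fun t ht => ⟨hd m t ⟨by linarith [ht.1], by linarith [ht.2]⟩, mem_univ _⟩)
      (by rw [hα0, hα0])
  -- The margin + 1 makes t an interior point of the interval with index ⌈|t|⌉, so the glued curve
  -- agrees with one local solution near t.
  have hmem : ∀ t : ℝ, t ∈ Ioo (-((⌈|t|⌉₊ : ℕ) + 1 : ℝ)) ((⌈|t|⌉₊ : ℕ) + 1) := by
    intro t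
    have := Nat.le_ceil |t|
    have := abs_le.1 this
    exact ⟨by linarith [this.1], by linarith [this.2]⟩
  have heq : ∀ n : ℕ, ∀ t ∈ Ioo (-(n + 1 : ℝ)) (n + 1), α ⌈|t|⌉₊ t = α n t := by
    intro n t ht
    rcases le_total n ⌈|t|⌉₊ with h | h
    · exact (hcomp n _ h ht).symm
    · exact hcomp _ n h (hmem t)
  refine ⟨fun t => α ⌈|t|⌉₊ t, by simp [hα0], fun t => ?_⟩
  refine (hd _ t (hmem t)).congr_of_eventuallyEq ?_
  filter_upwards [Ioo_mem_nhds (hmem t).1 (hmem t).2] with s hs using heq _ s hs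

/-- Gronwall for the squared distance E: from |E'| ≤ 2LE, the function exp(-2Lt) E is decreasing and
exp(2Lt) E is increasing. Both directions of time are needed, one for the Lipschitz bound on the
flow and the other for its inverse. -/
lemma abs_curve_sub_le (hu : IsVelocity L B u) {γ₁ γ₂ : ℝ → ℝ}
    (h₁ : ∀ t, HasDerivAt γ₁ (u t (γ₁ t)) t) (h₂ : ∀ t, HasDerivAt γ₂ (u t (γ₂ t)) t) (s t : ℝ) :
    |γ₁ t - γ₂ t| ≤ Real.exp (L * |t - s|) * |γ₁ s - γ₂ s| := by
  set E : ℝ → ℝ := fun t => (γ₁ t - γ₂ t) ^ 2 with hE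
  set E' : ℝ → ℝ := fun t => 2 * (γ₁ t - γ₂ t) * (u t (γ₁ t) - u t (γ₂ t)) with hE'
  have hEd : ∀ t, HasDerivAt E (E' t) t := fun t => by
    have := ((h₁ t).sub (h₂ t)).pow 2
    simpa [hE, hE'] using! this
  have hbd : ∀ t, |E' t| ≤ 2 * L * E t := fun t => by
    have h := mul_le_mul_of_nonneg_left (hu.lip t (γ₁ t) (γ₂ t)) (abs_nonneg (γ₁ t - γ₂ t))
    have h2 : |γ₁ t - γ₂ t| * |γ₁ t - γ₂ t| = (γ₁ t - γ₂ t) ^ 2 := by rw [← sq, sq_abs]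
    simp only [hE', hE, abs_mul, abs_two]
    rw [← h2]
    linarith
  have hexp : ∀ c t, HasDerivAt (fun t => Real.exp (c * t) * E t)
      (Real.exp (c * t) * (c * E t + E' t)) t := fun c t => by
    have h1 : HasDerivAt (fun t => Real.exp (c * t)) (Real.exp (c * t) * c) t := by
      simpa using ((hasDerivAt_id t).const_mul c).exp
    refine (h1.mul (hEd t)).congr_deriv ?_
    ring
  have hsq : E t ≤ Real.exp (2 * L * |t - s|) * E s := by
    rcases le_total s t with hst | hst
    · have hanti : Antitone fun t => Real.exp (-(2 * L) * t) * E t := by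
        refine antitone_of_deriv_nonpos (fun t => (hexp _ t).differentiableAt) fun t => ?_
        rw [(hexp _ t).deriv]
        refine mul_nonpos_of_nonneg_of_nonpos (Real.exp_pos _).le ?_
        linarith [le_abs_self (E' t), hbd t]
      have h := mul_le_mul_of_nonneg_left (hanti hst) (Real.exp_pos (2 * L * t)).le
      simp only [← mul_assoc, ← Real.exp_add] at h
      rw [abs_of_nonneg (sub_nonneg.2 hst)]
      rw [neg_mul, add_neg_cancel, Real.exp_zero, one_mul] at h
      rwa [mul_sub, sub_eq_add_neg, ← neg_mul (2 * L) s]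
    · have hmono : Monotone fun t => Real.exp (2 * L * t) * E t := by
        refine monotone_of_deriv_nonneg (fun t => (hexp _ t).differentiableAt) fun t => ?_
        rw [(hexp _ t).deriv]
        refine mul_nonneg (Real.exp_pos _).le ?_
        linarith [neg_abs_le (E' t), hbd t]
      have h := mul_le_mul_of_nonneg_left (hmono hst) (Real.exp_pos (-(2 * L * t))).le
      simp only [← mul_assoc, ← Real.exp_add] at h
      rw [abs_of_nonpos (sub_nonpos.2 hst)]
      rw [neg_add_cancel, Real.exp_zero, one_mul] at h
      rwa [neg_sub, mul_sub, sub_eq_neg_add]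
  refine abs_le_of_sq_le_sq' ?_ (by positivity) |> abs_le.2
  rw [mul_pow, sq_abs, ← Real.exp_nat_mul]
  convert! hsq using 3
  push_cast
  ring

end IsVelocity

open Classical in
/-- The flow of a velocity field, started at time `0`. -/
noncomputable def flow (u : ℝ → ℝ → ℝ) (t x : ℝ) : ℝ :=
  if h : ∃ α : ℝ → ℝ, α 0 = x ∧ ∀ t, HasDerivAt α (u t (α t)) t then h.choose t else x

/-- The inverse of the flow map at time `t`. -/
noncomputable def flowInv (u : ℝ → ℝ → ℝ) (t : ℝ) : ℝ → ℝ := Function.invFun (flow u t)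

namespace IsVelocity

variable {L B : ℝ} {u : ℝ → ℝ → ℝ}

lemma flow_zero (hu : IsVelocity L B u) (x : ℝ) : flow u 0 x = x := by
  have h := hu.exists_curve x
  simp only [flow, h, dif_pos]
  exact h.choose_spec.1

lemma hasDerivAt_flow (hu : IsVelocity L B u) (t x : ℝ) :
    HasDerivAt (fun s => flow u s x) (u t (flow u t x)) t := by
  have h := hu.exists_curve x
  simp only [flow, h, dif_pos]
  exact h.choose_spec.2 t

lemma abs_flow_sub_le (hu : IsVelocity L B u) (t x y : ℝ) :
    |flow u t x - flow u t y| ≤ Real.exp (L * |t|) * |x - y| := by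
  have := hu.abs_curve_sub_le (fun t => hu.hasDerivAt_flow t x) (fun t => hu.hasDerivAt_flow t y) 0 t
  simpa [hu.flow_zero] using this

lemma abs_sub_le_flow (hu : IsVelocity L B u) (t x y : ℝ) :
    |x - y| ≤ Real.exp (L * |t|) * |flow u t x - flow u t y| := by
  have := hu.abs_curve_sub_le (fun t => hu.hasDerivAt_flow t x) (fun t => hu.hasDerivAt_flow t y) t 0
  simpa [hu.flow_zero] using this

lemma abs_flow_sub_flow_time_le (hu : IsVelocity L B u) (s t x : ℝ) :
    |flow u t x - flow u s x| ≤ B * |t - s| := by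
  have := convex_univ.norm_image_sub_le_of_norm_hasDerivWithin_le (f := fun s => flow u s x)
    (fun r _ => (hu.hasDerivAt_flow r x).hasDerivWithinAt) (fun r _ => hu.bdd r _)
    (mem_univ s) (mem_univ t)
  simpa using this

lemma continuous_flow (hu : IsVelocity L B u) : Continuous fun p : ℝ × ℝ => flow u p.1 p.2 := by
  rw [continuous_iff_continuousAt]
  rintro ⟨t, x⟩
  rw [ContinuousAt, tendsto_iff_dist_tendsto_zero]
  have hlim : Tendsto (fun p : ℝ × ℝ => B * |p.1 - t| + Real.exp (L * |t|) * |p.2 - x|)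
      (𝓝 (t, x)) (𝓝 0) := by
    have : Continuous fun p : ℝ × ℝ => B * |p.1 - t| + Real.exp (L * |t|) * |p.2 - x| := by
      fun_prop
    simpa using this.tendsto (t, x)
  refine squeeze_zero (fun _ => dist_nonneg) (fun p => ?_) hlim
  calc dist (flow u p.1 p.2) (flow u t x)
      ≤ dist (flow u p.1 p.2) (flow u t p.2) + dist (flow u t p.2) (flow u t x) :=
        dist_triangle _ _ _
    _ ≤ _ := add_le_add (hu.abs_flow_sub_flow_time_le _ _ _) (hu.abs_flow_sub_le _ _ _)

lemma injective_flow (hu : IsVelocity L B u) (t : ℝ) : Function.Injective (flow u t) := by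
  intro x y h
  have := hu.abs_sub_le_flow t x y
  rw [h, sub_self, abs_zero, mul_zero] at this
  exact sub_eq_zero.1 (abs_nonpos_iff.1 this)

lemma continuous_flow_right (hu : IsVelocity L B u) (t : ℝ) : Continuous (flow u t) :=
  hu.continuous_flow.comp (Continuous.prodMk_right t)

/-- The displacement is at most B|t|, so the flow map is continuous and tends to ±∞ with its
argument. -/
lemma surjective_flow (hu : IsVelocity L B u) (t : ℝ) : Function.Surjective (flow u t) := by
  have h : ∀ x, |flow u t x - x| ≤ B * |t| := fun x => by
    simpa [hu.flow_zero] using hu.abs_flow_sub_flow_time_le 0 t x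
  refine (hu.continuous_flow_right t).surjective ?_ ?_
  · refine tendsto_atTop_mono (fun x => ?_) (tendsto_atTop_add_const_right atTop (-(B * |t|)) tendsto_id)
    have := (abs_le.1 (h x)).1
    simp only [id]
    linarith
  · refine tendsto_atBot_mono (fun x => ?_) (tendsto_atBot_add_const_right atBot (B * |t|) tendsto_id)
    have := (abs_le.1 (h x)).2
    simp only [id]
    linarith

lemma flow_flowInv (hu : IsVelocity L B u) (t z : ℝ) : flow u t (flowInv u t z) = z :=
  Function.rightInverse_invFun (hu.surjective_flow t) z

lemma flowInv_flow (hu : IsVelocity L B u) (t x : ℝ) : flowInv u t (flow u t x) = x :=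
  Function.leftInverse_invFun (hu.injective_flow t) x

/-- Orbits do not cross: by injectivity at every time, the difference of two orbits never vanishes,
so by the intermediate value theorem it keeps its sign at time 0. -/
lemma strictMono_flow (hu : IsVelocity L B u) (t : ℝ) : StrictMono (flow u t) := by
  have hne : ∀ {x y : ℝ}, x < y → ∀ s, flow u s x ≠ flow u s y :=
    fun h s he => h.ne (hu.injective_flow s he)
  intro x y hxy
  by_contra hcon
  push Not at hcon
  have hc : Continuous fun s => flow u s y - flow u s x :=
    (hu.continuous_flow.comp (Continuous.prodMk_left y)).sub
      (hu.continuous_flow.comp (Continuous.prodMk_left x))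
  have hzero : (0 : ℝ) ∈ Icc (flow u t y - flow u t x) (flow u 0 y - flow u 0 x) := by
    rw [hu.flow_zero, hu.flow_zero]
    exact ⟨by linarith, by linarith⟩
  obtain ⟨s, hs⟩ := mem_range_of_exists_le_of_exists_ge hc ⟨t, hzero.1⟩ ⟨0, hzero.2⟩
  exact hne hxy s (by linarith)

/-- The inverse Lipschitz bound at the varying time moves the comparison to the images, where the
orbit through the fixed preimage is B-Lipschitz in time. -/
lemma continuous_flowInv (hu : IsVelocity L B u) :
    Continuous fun p : ℝ × ℝ => flowInv u p.1 p.2 := by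
  rw [continuous_iff_continuousAt]
  rintro ⟨t, z⟩
  rw [ContinuousAt, tendsto_iff_dist_tendsto_zero]
  have hlim : Tendsto (fun p : ℝ × ℝ => Real.exp (L * |p.1|) * (|p.2 - z| + B * |t - p.1|))
      (𝓝 (t, z)) (𝓝 0) := by
    have : Continuous fun p : ℝ × ℝ => Real.exp (L * |p.1|) * (|p.2 - z| + B * |t - p.1|) := by
      fun_prop
    simpa using this.tendsto (t, z)
  refine squeeze_zero (fun _ => dist_nonneg) (fun p => ?_) hlim
  refine (hu.abs_sub_le_flow p.1 _ _).trans ?_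
  refine mul_le_mul_of_nonneg_left ?_ (Real.exp_pos _).le
  rw [hu.flow_flowInv]
  have h := hu.abs_flow_sub_flow_time_le p.1 t (flowInv u t z)
  rw [hu.flow_flowInv] at h
  calc |p.2 - flow u p.1 (flowInv u t z)|
      = |(p.2 - z) + (z - flow u p.1 (flowInv u t z))| := by ring_nf
    _ ≤ _ := (abs_add_le _ _).trans (add_le_add_right h _)

/-- Two orbits differ by the initial difference times the exponential of the integrated slopes. -/
lemma flow_sub_flow_eq (hu : IsVelocity L B u) {a : ℝ → ℝ → ℝ → ℝ}
    (ha : Continuous fun p : ℝ × ℝ × ℝ => a p.1 p.2.1 p.2.2)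
    (hua : ∀ t x y, u t y - u t x = a t x y * (y - x)) (t x y : ℝ) :
    flow u t y - flow u t x =
      (y - x) * Real.exp (∫ s in (0 : ℝ)..t, a s (flow u s x) (flow u s y)) := by
  set b : ℝ → ℝ := fun s => a s (flow u s x) (flow u s y) with hb
  have hbc : Continuous b := ha.comp (continuous_id.prodMk
    ((hu.continuous_flow.comp (Continuous.prodMk_left x)).prodMk
      (hu.continuous_flow.comp (Continuous.prodMk_left y))))
  set P : ℝ → ℝ := fun t => ∫ s in (0 : ℝ)..t, b s with hP
  have hPd : ∀ t, HasDerivAt P (b t) t := fun t => hbc.integral_hasStrictDerivAt 0 t |>.hasDerivAt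
  have hQ : ∀ t, HasDerivAt (fun t => (flow u t y - flow u t x) * Real.exp (-P t)) 0 t := by
    intro t
    have h1 := ((hu.hasDerivAt_flow t y).sub (hu.hasDerivAt_flow t x)).mul (hPd t).neg.exp
    refine h1.congr_deriv ?_
    simp only [Pi.sub_apply, Pi.neg_apply]
    rw [hua t (flow u t x) (flow u t y)]
    simp only [hb]
    ring
  have hconst := is_const_of_deriv_eq_zero (fun t => (hQ t).differentiableAt)
    (fun t => (hQ t).deriv) t 0
  simp only [hP, intervalIntegral.integral_same, neg_zero, Real.exp_zero, mul_one,
    hu.flow_zero] at hconst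
  rw [← hconst, mul_assoc, ← Real.exp_add]
  simp

/-- The velocity has the continuous divided difference a(t, x, y) = ∫₀¹ u'(t, x + θ(y - x)) dθ, with
a(t, x, x) = u'(t, x). By `flow_sub_flow_eq` the difference quotient of the flow is exactly exp ∫ a
along the two orbits, and y → x is then a continuity statement. -/
lemma hasDerivAt_flow_right (hu : IsVelocity L B u) {u' : ℝ → ℝ → ℝ}
    (hu' : Continuous fun p : ℝ × ℝ => u' p.1 p.2) (hd : ∀ t x, HasDerivAt (u t) (u' t x) x)
    (t x : ℝ) :
    HasDerivAt (flow u t) (Real.exp (∫ s in (0 : ℝ)..t, u' s (flow u s x))) x := by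
  set a : ℝ → ℝ → ℝ → ℝ := fun t x y => ∫ θ in (0 : ℝ)..1, u' t (x + θ * (y - x)) with ha
  have hac : Continuous fun p : ℝ × ℝ × ℝ => a p.1 p.2.1 p.2.2 := by
    refine intervalIntegral.continuous_parametric_intervalIntegral_of_continuous'
      (f := fun (p : ℝ × ℝ × ℝ) θ => u' p.1 (p.2.1 + θ * (p.2.2 - p.2.1))) ?_ 0 1
    have : Continuous fun q : (ℝ × ℝ × ℝ) × ℝ =>
        (q.1.1, q.1.2.1 + q.2 * (q.1.2.2 - q.1.2.1)) := by fun_prop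
    exact hu'.comp this
  have hua : ∀ t x y, u t y - u t x = a t x y * (y - x) := by
    intro t x y
    have h1 : ∀ θ ∈ uIcc (0 : ℝ) 1, HasDerivAt (fun θ => u t (x + θ * (y - x)))
        (u' t (x + θ * (y - x)) * (y - x)) θ := by
      intro θ _
      have h2 : HasDerivAt (fun θ : ℝ => x + θ * (y - x)) (y - x) θ := by
        simpa using ((hasDerivAt_id θ).mul_const (y - x)).const_add x
      exact (hd t _).comp θ h2
    have hcont : Continuous fun θ : ℝ => u' t (x + θ * (y - x)) * (y - x) := by
      have : Continuous fun θ : ℝ => (t, x + θ * (y - x)) := by fun_prop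
      exact (hu'.comp this).mul continuous_const
    have h3 := intervalIntegral.integral_eq_sub_of_hasDerivAt h1 (hcont.intervalIntegrable _ _)
    rw [intervalIntegral.integral_mul_const] at h3
    simp only [ha]
    rw [h3]
    ring_nf
  have hdiag : ∀ t x, a t x x = u' t x := fun t x => by simp [ha]
  set F : ℝ → ℝ := fun y => Real.exp (∫ s in (0 : ℝ)..t, a s (flow u s x) (flow u s y)) with hF
  have hFc : Continuous F := by
    refine Real.continuous_exp.comp ?_
    refine intervalIntegral.continuous_parametric_intervalIntegral_of_continuous'
      (f := fun y s => a s (flow u s x) (flow u s y)) ?_ 0 t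
    exact hac.comp (continuous_snd.prodMk
      ((hu.continuous_flow.comp (continuous_snd.prodMk continuous_const)).prodMk
        (hu.continuous_flow.comp (continuous_snd.prodMk continuous_fst))))
  have hFx : F x = Real.exp (∫ s in (0 : ℝ)..t, u' s (flow u s x)) := by simp only [hF, hdiag]
  rw [← hFx, hasDerivAt_iff_tendsto_slope]
  refine (hFc.continuousAt.tendsto.mono_left nhdsWithin_le_nhds).congr' ?_
  filter_upwards [self_mem_nhdsWithin] with y hy
  rw [slope_def_field, hu.flow_sub_flow_eq hac hua, mul_div_cancel_left₀ _ (sub_ne_zero.2 hy)]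

/-- Bootstrap: the derivative exp ∫ u'(s, X) involves only the flow itself, so smoothness of order k
of X and u' gives order k + 1 of X. -/
lemma jointC_flow (hu : IsVelocity L B u) {k : ℕ} (hk : JointC k u) : JointC k (flow u) := by
  induction k with
  | zero => exact hu.continuous_flow
  | succ k ih =>
    have hX := ih hk.of_succ
    obtain ⟨_, u', hd, hu'⟩ := hk
    exact ⟨hu.continuous_flow, _, hu.hasDerivAt_flow_right hu'.continuous hd,
      JointC.contDiff_comp Real.contDiff_exp (hu'.comp hX).integral⟩

/-- The same bootstrap for the inverse, whose derivative at z is exp(-∫ u'(s, X)) on the orbit that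
reaches z at time t. -/
lemma jointC_flowInv (hu : IsVelocity L B u) {k : ℕ} (hk : JointC k u) :
    JointC k (flowInv u) := by
  induction k with
  | zero => exact hu.continuous_flowInv
  | succ k ih =>
    have hA := ih hk.of_succ
    have hX := hu.jointC_flow hk.of_succ
    obtain ⟨_, u', hd, hu'⟩ := hk
    set I : ℝ → ℝ → ℝ := fun t x => ∫ s in (0 : ℝ)..t, u' s (flow u s x) with hI
    have hIk : JointC k I := (hu'.comp hX).integral
    refine ⟨hu.continuous_flowInv, fun t z => Real.exp (-I t (flowInv u t z)), fun t z => ?_,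
      JointC.contDiff_comp Real.contDiff_exp (hIk.comp hA).neg⟩
    simp only [Real.exp_neg]
    exact HasDerivAt.of_local_left_inverse
      (hu.continuous_flowInv.comp (Continuous.prodMk_right t)).continuousAt
      (hu.hasDerivAt_flow_right hu'.continuous hd t _) (Real.exp_ne_zero _)
      (Eventually.of_forall fun z => hu.flow_flowInv t z)

/-- The flow map at time `t` as a homeomorphism of the line. -/
noncomputable def flowHomeo (hu : IsVelocity L B u) (t : ℝ) : ℝ ≃ₜ ℝ where
  toFun := flow u t
  invFun := flowInv u t
  left_inv := hu.flowInv_flow t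
  right_inv := hu.flow_flowInv t
  continuous_toFun := hu.continuous_flow_right t
  continuous_invFun := hu.continuous_flowInv.comp (Continuous.prodMk_right t)

end IsVelocity

end HouLuoModel

/-! ### Truncated Biot-Savart law and transport -/

namespace HouLuoModel

/-- `f` is bounded by `N` and Lipschitz with constant `N`. -/
structure BddLip (N : ℝ) (f : ℝ → ℝ) : Prop where
  bdd : ∀ x, |f x| ≤ N
  lip : ∀ x y, |f x - f y| ≤ N * |x - y|

lemma BddLip.nonneg {N : ℝ} {f : ℝ → ℝ} (hf : BddLip N f) : 0 ≤ N :=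
  (abs_nonneg _).trans (hf.bdd 0)

lemma BddLip.mono {N N' : ℝ} {f : ℝ → ℝ} (hf : BddLip N f) (h : N ≤ N') : BddLip N' f :=
  ⟨fun x => (hf.bdd x).trans h,
    fun x y => (hf.lip x y).trans (mul_le_mul_of_nonneg_right h (abs_nonneg _))⟩

lemma BddLip.continuous {N : ℝ} {f : ℝ → ℝ} (hf : BddLip N f) : Continuous f :=
  (LipschitzWith.of_dist_le_mul (K := N.toNNReal) fun x y => by
    rw [Real.coe_toNNReal _ hf.nonneg]
    exact hf.lip x y).continuous

lemma exists_bddLip {f : ℝ → ℝ} (hf : ContDiff ℝ 1 f) (hs : HasCompactSupport f) :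
    ∃ N, BddLip N f := by
  obtain ⟨A, hA⟩ := hf.continuous.bounded_above_of_compact_support hs
  obtain ⟨K, hK⟩ := hf.lipschitzWith_of_hasCompactSupport hs one_ne_zero
  refine ⟨max A K, fun x => (hA x).trans (le_max_left _ _), fun x y => ?_⟩
  exact (hK.dist_le_mul x y).trans (mul_le_mul_of_nonneg_right (le_max_right _ _) dist_nonneg)

/-- Smooth truncations `χ` of `1/x` and `θ` of `x`, exact on `[c,1]` and `[0,1]` respectively. -/
structure Cutoff (c : ℝ) where
  χ : ℝ → ℝ
  θ : ℝ → ℝ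
  K : ℝ
  K_pos : 0 < K
  χ_smooth : ∀ k : ℕ, ContDiff ℝ k χ
  θ_smooth : ∀ k : ℕ, ContDiff ℝ k θ
  χ_bddLip : BddLip K χ
  θ_bddLip : BddLip K θ
  χ_left : ∀ y ≤ 0, χ y = 0
  χ_right : ∀ y, 2 ≤ y → χ y = 0
  χ_eq : ∀ y ∈ Icc c 1, χ y = y⁻¹
  θ_eq : ∀ x ∈ Icc (0 : ℝ) 1, θ x = x

/-- The first transition factor of χ vanishes for y ≤ c/2, which removes the singularity of 1/y, and
equals 1 from y = c on; the factor in 2 - y is 1 up to 1 and vanishes from 2 on. -/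
lemma nonempty_cutoff {c : ℝ} (hc : 0 < c) : Nonempty (Cutoff c) := by
  set χ : ℝ → ℝ := fun y =>
    Real.smoothTransition (2 * y / c - 1) * y⁻¹ * Real.smoothTransition (2 - y) with hχ
  set θ : ℝ → ℝ := fun x =>
    x * Real.smoothTransition (x + 1) * Real.smoothTransition (2 - x) with hθ
  have hχl : ∀ y ≤ c / 2, χ y = 0 := fun y hy => by
    have : 2 * y / c - 1 ≤ 0 := by
      rw [sub_nonpos, div_le_one hc]
      linarith
    simp [hχ, Real.smoothTransition.zero_of_nonpos this]
  have hχr : ∀ y, 2 ≤ y → χ y = 0 := fun y hy => by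
    simp [hχ, Real.smoothTransition.zero_of_nonpos (by linarith : 2 - y ≤ 0)]
  have hχs : ∀ k : ℕ, ContDiff ℝ k χ := by
    intro k
    rw [contDiff_iff_contDiffAt]
    intro y
    rcases lt_or_ge y (c / 2) with hy | hy
    · refine (contDiffAt_const (c := (0 : ℝ))).congr_of_eventuallyEq ?_
      filter_upwards [Iio_mem_nhds hy] with z hz using hχl z (le_of_lt hz)
    · have hy0 : y ≠ 0 := by linarith
      have h1 : ContDiff ℝ k fun y : ℝ => Real.smoothTransition (2 * y / c - 1) :=
        Real.smoothTransition.contDiff.comp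
          (((contDiff_const.mul contDiff_id).div_const c).sub contDiff_const)
      have h2 : ContDiff ℝ k fun y : ℝ => Real.smoothTransition (2 - y) :=
        Real.smoothTransition.contDiff.comp (contDiff_const.sub contDiff_id)
      exact (h1.contDiffAt.mul (contDiffAt_inv ℝ hy0)).mul h2.contDiffAt
  have hθs : ∀ k : ℕ, ContDiff ℝ k θ := by
    intro k
    have h1 : ContDiff ℝ k fun y : ℝ => Real.smoothTransition (y + 1) :=
      Real.smoothTransition.contDiff.comp (contDiff_id.add contDiff_const)
    have h2 : ContDiff ℝ k fun y : ℝ => Real.smoothTransition (2 - y) :=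
      Real.smoothTransition.contDiff.comp (contDiff_const.sub contDiff_id)
    exact (contDiff_id.mul h1).mul h2
  obtain ⟨N₁, hN₁⟩ := exists_bddLip (by exact_mod_cast hχs 1)
    (HasCompactSupport.intro (isCompact_Icc (a := c / 2) (b := 2)) fun y hy => by
      rw [mem_Icc, not_and_or] at hy
      rcases hy with hy | hy
      · exact hχl y (le_of_not_ge hy)
      · exact hχr y (le_of_not_ge hy))
  obtain ⟨N₂, hN₂⟩ := exists_bddLip (by exact_mod_cast hθs 1)
    (HasCompactSupport.intro (isCompact_Icc (a := (-1 : ℝ)) (b := 2)) fun y hy => by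
      rw [mem_Icc, not_and_or] at hy
      rcases hy with hy | hy
      · simp [hθ, Real.smoothTransition.zero_of_nonpos (by linarith : y + 1 ≤ 0)]
      · simp [hθ, Real.smoothTransition.zero_of_nonpos (by linarith : 2 - y ≤ 0)])
  refine ⟨⟨χ, θ, max 1 (max N₁ N₂), lt_of_lt_of_le one_pos (le_max_left _ _), hχs, hθs,
    hN₁.mono ((le_max_left _ _).trans (le_max_right _ _)),
    hN₂.mono ((le_max_right _ _).trans (le_max_right _ _)),
    fun y hy => hχl y (by linarith), hχr, fun y hy => ?_, fun x hx => ?_⟩⟩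
  · have h1 : 1 ≤ 2 * y / c - 1 := by
      rw [le_sub_iff_add_le, le_div_iff₀ hc]
      linarith [hy.1]
    simp [hχ, Real.smoothTransition.one_of_one_le h1,
      Real.smoothTransition.one_of_one_le (by linarith [hy.2] : 1 ≤ 2 - y)]
  · simp [hθ, Real.smoothTransition.one_of_one_le (by linarith [hx.1] : 1 ≤ x + 1),
      Real.smoothTransition.one_of_one_le (by linarith [hx.2] : 1 ≤ 2 - x)]

/-- Jointly continuous functions bounded by `M`. -/
structure Adm (M : ℝ) (w : ℝ → ℝ → ℝ) : Prop where
  cont : Continuous fun p : ℝ × ℝ => w p.1 p.2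
  bdd : ∀ t x, |w t x| ≤ M

lemma Adm.nonneg {M : ℝ} {w : ℝ → ℝ → ℝ} (hw : Adm M w) : 0 ≤ M :=
  (abs_nonneg _).trans (hw.bdd 0 0)

namespace Cutoff

variable {c : ℝ} (C : Cutoff c)

lemma continuous_χ : Continuous C.χ := C.χ_bddLip.continuous

lemma continuous_θ : Continuous C.θ := C.θ_bddLip.continuous

/-- The truncated version of `∫_a^1 w(y)/y dy`. -/
noncomputable def tail (w : ℝ → ℝ) (a : ℝ) : ℝ := ∫ y in a..2, C.χ y * w y

/-- The truncated Biot-Savart law. -/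
noncomputable def vel (β₁ β₂ : ℝ) (w : ℝ → ℝ) (x : ℝ) : ℝ :=
  C.θ x * (C.tail w (β₂ * x) - 2 * C.tail w (β₁ * x))

lemma intervalIntegrable {w : ℝ → ℝ} (hw : Continuous w) (a b : ℝ) :
    IntervalIntegrable (fun y => C.χ y * w y) volume a b :=
  (C.continuous_χ.mul hw).intervalIntegrable a b

lemma tail_sub {w₁ w₂ : ℝ → ℝ} (h₁ : Continuous w₁) (h₂ : Continuous w₂) (a : ℝ) :
    C.tail w₁ a - C.tail w₂ a = C.tail (fun y => w₁ y - w₂ y) a := by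
  simp only [tail]
  rw [← intervalIntegral.integral_sub (C.intervalIntegrable h₁ _ _) (C.intervalIntegrable h₂ _ _)]
  simp only [mul_sub]

lemma tail_sub_tail {w : ℝ → ℝ} (hw : Continuous w) (a b : ℝ) :
    C.tail w a - C.tail w b = ∫ y in a..b, C.χ y * w y := by
  simp only [tail]
  rw [sub_eq_iff_eq_add]
  exact (intervalIntegral.integral_add_adjacent_intervals (C.intervalIntegrable hw _ _)
    (C.intervalIntegrable hw _ _)).symm

lemma abs_integral_le {w : ℝ → ℝ} {M : ℝ} (hM : ∀ y, |w y| ≤ M) (a b : ℝ) :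
    |∫ y in a..b, C.χ y * w y| ≤ C.K * M * |a - b| := by
  rw [abs_sub_comm, ← Real.norm_eq_abs (∫ y in a..b, _)]
  refine intervalIntegral.norm_integral_le_of_norm_le_const fun y _ => ?_
  rw [norm_mul]
  exact mul_le_mul (C.χ_bddLip.bdd y) (hM y) (norm_nonneg _) C.K_pos.le

lemma abs_tail_sub_le {w : ℝ → ℝ} {M : ℝ} (hw : Continuous w) (hM : ∀ y, |w y| ≤ M) (a b : ℝ) :
    |C.tail w a - C.tail w b| ≤ C.K * M * |a - b| := by
  rw [C.tail_sub_tail hw]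
  exact C.abs_integral_le hM a b

/-- χ vanishes outside [0, 2], so the integral is unchanged when a is moved to that interval. This
makes the velocity bounded on the whole line, as a global flow requires. -/
lemma abs_tail_le {w : ℝ → ℝ} {M : ℝ} (hw : Continuous w) (hM : ∀ y, |w y| ≤ M) (a : ℝ) :
    |C.tail w a| ≤ 2 * C.K * M := by
  have hM0 : 0 ≤ M := (abs_nonneg _).trans (hM 0)
  have key : ∀ a ∈ Icc (0 : ℝ) 2, |C.tail w a| ≤ 2 * C.K * M := fun a ha => by
    refine (C.abs_integral_le hM a 2).trans ?_
    have h1 : |a - 2| ≤ 2 := abs_le.2 ⟨by linarith [ha.1], by linarith [ha.2]⟩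
    have h2 : 0 ≤ C.K * M := mul_nonneg C.K_pos.le hM0
    nlinarith
  rcases lt_or_ge a 0 with h | h
  · have h1 := C.tail_sub_tail hw a 0
    rw [intervalIntegral.integral_congr (g := fun _ => (0 : ℝ)), intervalIntegral.integral_zero,
      sub_eq_zero] at h1
    · rw [h1]
      exact key 0 (by norm_num)
    · intro y hy
      rw [uIcc_of_le h.le] at hy
      simp [C.χ_left y hy.2]
  · rcases le_or_gt a 2 with h' | h'
    · exact key a ⟨h, h'⟩
    · have : C.tail w a = 0 := by
        simp only [tail]
        rw [intervalIntegral.integral_congr (g := fun _ => (0 : ℝ)),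
          intervalIntegral.integral_zero]
        intro y hy
        rw [uIcc_of_ge h'.le] at hy
        simp [C.χ_right y hy.1]
      rw [this, abs_zero]
      exact mul_nonneg (mul_nonneg two_pos.le C.K_pos.le) hM0

lemma abs_vel_le {β₁ β₂ : ℝ} {w : ℝ → ℝ} {M : ℝ} (hw : Continuous w) (hM : ∀ y, |w y| ≤ M)
    (x : ℝ) : |C.vel β₁ β₂ w x| ≤ 6 * C.K ^ 2 * M := by
  have h1 := C.abs_tail_le hw hM (β₂ * x)
  have h2 := C.abs_tail_le hw hM (β₁ * x)
  have h3 : |C.tail w (β₂ * x) - 2 * C.tail w (β₁ * x)| ≤ 6 * C.K * M := by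
    rw [abs_le] at h1 h2 ⊢
    constructor <;> linarith [h1.1, h1.2, h2.1, h2.2]
  rw [vel, abs_mul]
  refine (mul_le_mul (C.θ_bddLip.bdd x) h3 (abs_nonneg _) C.K_pos.le).trans (le_of_eq ?_)
  ring

lemma abs_vel_sub_vel_le {β₁ β₂ : ℝ} {w₁ w₂ : ℝ → ℝ} {D : ℝ} (h₁ : Continuous w₁)
    (h₂ : Continuous w₂) (hD : ∀ y, |w₁ y - w₂ y| ≤ D) (x : ℝ) :
    |C.vel β₁ β₂ w₁ x - C.vel β₁ β₂ w₂ x| ≤ 6 * C.K ^ 2 * D := by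
  have : C.vel β₁ β₂ w₁ x - C.vel β₁ β₂ w₂ x = C.vel β₁ β₂ (fun y => w₁ y - w₂ y) x := by
    simp only [vel, ← C.tail_sub h₁ h₂]
    ring
  rw [this]
  exact C.abs_vel_le (h₁.sub h₂) hD x

/-- The Lipschitz constant of the truncated velocity of a function bounded by `M`. -/
noncomputable def lipConst (β₁ β₂ M : ℝ) : ℝ := 6 * C.K ^ 2 * M + (β₂ + 2 * β₁) * C.K ^ 2 * M

lemma abs_vel_lip {β₁ β₂ : ℝ} (hβ₁ : 0 ≤ β₁) (hβ₂ : 0 ≤ β₂) {w : ℝ → ℝ} {M : ℝ}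
    (hw : Continuous w) (hM : ∀ y, |w y| ≤ M) (x y : ℝ) :
    |C.vel β₁ β₂ w x - C.vel β₁ β₂ w y| ≤ C.lipConst β₁ β₂ M * |x - y| := by
  have hK := C.K_pos.le
  have h1 := C.abs_tail_le hw hM (β₂ * x)
  have h2 := C.abs_tail_le hw hM (β₁ * x)
  have h3 : |C.tail w (β₂ * x) - 2 * C.tail w (β₁ * x)| ≤ 6 * C.K * M := by
    rw [abs_le] at h1 h2 ⊢
    constructor <;> linarith [h1.1, h1.2, h2.1, h2.2]
  have h4 : |(C.tail w (β₂ * x) - 2 * C.tail w (β₁ * x)) -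
      (C.tail w (β₂ * y) - 2 * C.tail w (β₁ * y))| ≤ (β₂ + 2 * β₁) * C.K * M * |x - y| := by
    have h5 := C.abs_tail_sub_le hw hM (β₂ * x) (β₂ * y)
    have h6 := C.abs_tail_sub_le hw hM (β₁ * x) (β₁ * y)
    rw [← mul_sub, abs_mul, abs_of_nonneg hβ₂] at h5
    rw [← mul_sub, abs_mul, abs_of_nonneg hβ₁] at h6
    rw [abs_le] at h5 h6 ⊢
    constructor <;> linarith [h5.1, h5.2, h6.1, h6.2]
  have h7 : C.vel β₁ β₂ w x - C.vel β₁ β₂ w y =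
      (C.θ x - C.θ y) * (C.tail w (β₂ * x) - 2 * C.tail w (β₁ * x)) +
      C.θ y * ((C.tail w (β₂ * x) - 2 * C.tail w (β₁ * x)) -
        (C.tail w (β₂ * y) - 2 * C.tail w (β₁ * y))) := by
    simp only [vel]
    ring
  rw [h7]
  refine (abs_add_le _ _).trans ?_
  rw [abs_mul, abs_mul]
  refine (add_le_add (mul_le_mul (C.θ_bddLip.lip x y) h3 (abs_nonneg _)
    (mul_nonneg hK (abs_nonneg _))) (mul_le_mul (C.θ_bddLip.bdd y) h4 (abs_nonneg _) hK)).trans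
    (le_of_eq ?_)
  simp only [lipConst]
  ring

lemma continuous_tail {w : ℝ → ℝ → ℝ} (hw : Continuous fun p : ℝ × ℝ => w p.1 p.2) :
    Continuous fun p : ℝ × ℝ => C.tail (w p.1) p.2 := by
  have h : Continuous fun p : ℝ × ℝ => ∫ y in (2 : ℝ)..p.2, C.χ y * w p.1 y := by
    refine intervalIntegral.continuous_parametric_intervalIntegral_of_continuous
      (f := fun (p : ℝ × ℝ) y => C.χ y * w p.1 y) ?_ continuous_snd
    exact (C.continuous_χ.comp continuous_snd).mul
      (hw.comp ((continuous_fst.comp continuous_fst).prodMk continuous_snd))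
  simp only [tail]
  simp_rw [fun p : ℝ × ℝ => intervalIntegral.integral_symm (f := fun y => C.χ y * w p.1 y)
    (μ := volume) 2 p.2]
  exact h.neg

lemma isVelocity {β₁ β₂ : ℝ} (hβ₁ : 0 ≤ β₁) (hβ₂ : 0 ≤ β₂) {w : ℝ → ℝ → ℝ} {M : ℝ}
    (hw : Adm M w) :
    IsVelocity (C.lipConst β₁ β₂ M) (6 * C.K ^ 2 * M) (fun t => C.vel β₁ β₂ (w t)) where
  cont := by
    have h := C.continuous_tail hw.cont
    have h1 : ∀ b : ℝ, Continuous fun p : ℝ × ℝ => C.tail (w p.1) (b * p.2) := fun b =>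
      h.comp (continuous_fst.prodMk (continuous_const.mul continuous_snd))
    exact (C.continuous_θ.comp continuous_snd).mul ((h1 β₂).sub (continuous_const.mul (h1 β₁)))
  bdd t x := C.abs_vel_le (hw.cont.comp (Continuous.prodMk_right t)) (hw.bdd t) x
  lip t x y := C.abs_vel_lip hβ₁ hβ₂ (hw.cont.comp (Continuous.prodMk_right t)) (hw.bdd t) x y

/-- Differentiating in the endpoint returns -χw, so integration gains one derivative. This gain
drives the regularity bootstrap for the nonlinear system. -/
lemma jointC_tail {k : ℕ} {w : ℝ → ℝ → ℝ} (hw : JointC k w) :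
    JointC (k + 1) (fun t => C.tail (w t)) := by
  refine ⟨C.continuous_tail hw.continuous, fun t a => -(C.χ a * w t a), fun t a => ?_,
    ((JointC.of_contDiff (C.χ_smooth k)).mul hw).neg⟩
  have hc : Continuous fun y => C.χ y * w t y :=
    C.continuous_χ.mul (hw.continuous.comp (Continuous.prodMk_right t))
  exact intervalIntegral.integral_hasDerivAt_left (hc.intervalIntegrable _ _)
    hc.aestronglyMeasurable.stronglyMeasurableAtFilter hc.continuousAt

lemma jointC_vel {β₁ β₂ : ℝ} {k : ℕ} {w : ℝ → ℝ → ℝ} (hw : JointC k w) :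
    JointC (k + 1) (fun t => C.vel β₁ β₂ (w t)) := by
  have h := C.jointC_tail hw
  have h1 : ∀ b : ℝ, JointC (k + 1) (fun t x => C.tail (w t) (b * x)) := fun b =>
    h.comp ((JointC.id _).const_mul b)
  exact (JointC.of_contDiff (C.θ_smooth (k + 1))).mul ((h1 β₂).sub ((h1 β₁).const_mul 2))

/-- The solution of `∂ₜw + u ∂ₓw = χ g(A)` with initial value `f`, where `A` is the inverse flow. -/
noncomputable def transport (u : ℝ → ℝ → ℝ) (f g : ℝ → ℝ) (t z : ℝ) : ℝ :=
  f (flowInv u t z) + g (flowInv u t z) * ∫ s in (0 : ℝ)..t, C.χ (flow u s (flowInv u t z))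

lemma jointC_transport {L B : ℝ} {u : ℝ → ℝ → ℝ} (hu : IsVelocity L B u) {k : ℕ}
    (hk : JointC k u) {f g : ℝ → ℝ} (hf : ContDiff ℝ k f) (hg : ContDiff ℝ k g) :
    JointC k (C.transport u f g) := by
  have hA := hu.jointC_flowInv hk
  exact (JointC.contDiff_comp hf hA).add ((JointC.contDiff_comp hg hA).mul
    ((JointC.contDiff_comp (C.χ_smooth k) (hu.jointC_flow hk)).integral.comp hA))

lemma abs_integral_χ_le {γ : ℝ → ℝ} {t : ℝ} (ht : 0 ≤ t) :
    |∫ s in (0 : ℝ)..t, C.χ (γ s)| ≤ C.K * t := by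
  have := intervalIntegral.norm_integral_le_of_norm_le_const (a := 0) (b := t)
    (f := fun s => C.χ (γ s)) (C := C.K) fun s _ => C.χ_bddLip.bdd (γ s)
  rwa [sub_zero, abs_of_nonneg ht] at this

lemma abs_transport_le {u : ℝ → ℝ → ℝ} {f g : ℝ → ℝ} {N : ℝ} (hf : BddLip N f)
    (hg : BddLip N g) {t : ℝ} (ht : 0 ≤ t) (z : ℝ) :
    |C.transport u f g t z| ≤ N + N * (C.K * t) :=
  (abs_add_le _ _).trans (add_le_add (hf.bdd _) (by
    rw [abs_mul]
    exact mul_le_mul (hg.bdd _) (C.abs_integral_χ_le ht) (abs_nonneg _) hf.nonneg))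

lemma continuous_transport {L B : ℝ} {u : ℝ → ℝ → ℝ} (hu : IsVelocity L B u) {f g : ℝ → ℝ}
    (hf : Continuous f) (hg : Continuous g) :
    Continuous fun p : ℝ × ℝ => C.transport u f g p.1 p.2 :=
  C.jointC_transport (k := 0) hu hu.cont (contDiff_zero.2 hf) (contDiff_zero.2 hg)

end Cutoff

/-! ### Contraction, existence and uniqueness for the truncated system -/

/-- Flows of two velocities that are exponentially close in time. -/
lemma abs_flow_sub_flow_le {L B : ℝ} {u₁ u₂ : ℝ → ℝ → ℝ} (h₁ : IsVelocity L B u₁)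
    (h₂ : IsVelocity L B u₂) {S κ r : ℝ} (hκ : 0 < κ) (hr : L < r)
    (hd : ∀ s ∈ Icc 0 S, ∀ x, |u₁ s x - u₂ s x| ≤ κ * Real.exp (r * s))
    {t : ℝ} (ht : t ∈ Icc 0 S) (x : ℝ) :
    |flow u₁ t x - flow u₂ t x| ≤ 2 * κ / (r - L) * Real.exp (r * t) := by
  have hrL : 0 < r - L := sub_pos.2 hr
  set E : ℝ := 2 * κ / (r - L) with hE
  have hE0 : 0 < E := by positivity
  have hEr : E * (r - L) = 2 * κ := div_mul_cancel₀ _ hrL.ne'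
  refine image_norm_le_of_norm_deriv_right_lt_deriv_boundary (a := 0) (b := S)
    (f := fun s => flow u₁ s x - flow u₂ s x)
    (f' := fun s => u₁ s (flow u₁ s x) - u₂ s (flow u₂ s x))
    (B := fun s => E * Real.exp (r * s)) (B' := fun s => E * (Real.exp (r * s) * r))
    ?_ ?_ ?_ ?_ ?_ ht
  · exact fun s _ => ((h₁.hasDerivAt_flow s x).sub
      (h₂.hasDerivAt_flow s x)).continuousAt.continuousWithinAt
  · exact fun s _ => ((h₁.hasDerivAt_flow s x).sub (h₂.hasDerivAt_flow s x)).hasDerivWithinAt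
  · simp [h₁.flow_zero, h₂.flow_zero, hE0.le]
  · intro s
    have : HasDerivAt (fun s => Real.exp (r * s)) (Real.exp (r * s) * r) s := by
      simpa using ((hasDerivAt_id s).const_mul r).exp
    exact this.const_mul E
  -- When the difference touches the barrier E exp(rs), its speed is at most (LE + κ) exp(rs), while
  -- the barrier grows at the rate rE exp(rs) = (LE + 2κ) exp(rs). The factor 2 in E makes the
  -- comparison strict.
  · intro s hs heq
    have h3 := h₁.lip s (flow u₁ s x) (flow u₂ s x)
    have h4 := hd s (Ico_subset_Icc_self hs) (flow u₂ s x)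
    rw [Real.norm_eq_abs] at heq ⊢
    rw [heq] at h3
    have h5 : |u₁ s (flow u₁ s x) - u₂ s (flow u₂ s x)| ≤
        L * (E * Real.exp (r * s)) + κ * Real.exp (r * s) := by
      refine le_trans ?_ (add_le_add h3 h4)
      exact abs_sub_le _ _ _
    have h6 := Real.exp_pos (r * s)
    have h7 : E * (Real.exp (r * s) * r) =
        L * (E * Real.exp (r * s)) + 2 * κ * Real.exp (r * s) := by
      rw [← hEr]; ring
    rw [h7]
    nlinarith

/-- The solution operator `w ↦ transport (vel w)` halves exponentially weighted distances. -/
lemma Cutoff.exists_rate {c : ℝ} (C : Cutoff c) {β₁ β₂ : ℝ} (hβ₁ : 0 ≤ β₁) (hβ₂ : 0 ≤ β₂)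
    {M N T : ℝ} (hM : 0 ≤ M) (hN : 0 ≤ N) (hT : 0 ≤ T) :
    ∃ r : ℝ, 0 ≤ r ∧ ∀ f g : ℝ → ℝ, BddLip N f → BddLip N g →
      ∀ w₁ w₂ : ℝ → ℝ → ℝ, Adm M w₁ → Adm M w₂ → ∀ S ≤ T, ∀ D > 0,
      (∀ s ∈ Icc 0 S, ∀ x, |w₁ s x - w₂ s x| ≤ D * Real.exp (r * s)) →
      ∀ t ∈ Icc 0 S, ∀ z, |C.transport (fun t => C.vel β₁ β₂ (w₁ t)) f g t z -
        C.transport (fun t => C.vel β₁ β₂ (w₂ t)) f g t z| ≤ D / 2 * Real.exp (r * t) := by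
  have hK := C.K_pos
  set L := C.lipConst β₁ β₂ M with hL
  have hL0 : 0 ≤ L := by simp only [hL, lipConst]; positivity
  set G := Real.exp (L * T) with hG
  have hG0 : 0 < G := Real.exp_pos _
  -- The three terms of Q belong to the three parts of the splitting `hsplit`: the change of f, the
  -- change of g, and the change of the integral of χ.
  set Q := N * G + N * G * (C.K * T) + N * (C.K * (G * G + 1) * T) with hQ
  have hQ0 : 0 ≤ Q := by positivity
  set κ := 6 * C.K ^ 2 with hκ
  have hκ0 : 0 < κ := by positivity
  -- This choice gives E = D / (2(Q + 1)), hence QE ≤ D/2. It depends on M, N and T only, not on the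
  -- data or on the two functions compared.
  refine ⟨L + 4 * κ * (Q + 1), by positivity, ?_⟩
  set r := L + 4 * κ * (Q + 1) with hr
  intro f g hf hg w₁ w₂ hw₁ hw₂ S hS D hD hclose t ht z
  have h₁ := C.isVelocity hβ₁ hβ₂ hw₁
  have h₂ := C.isVelocity hβ₁ hβ₂ hw₂
  set u₁ := fun t => C.vel β₁ β₂ (w₁ t) with hu₁
  set u₂ := fun t => C.vel β₁ β₂ (w₂ t) with hu₂
  have hrL : L < r := by
    have : 0 < 4 * κ * (Q + 1) := by positivity
    linarith
  have hX : ∀ s ∈ Icc 0 S, ∀ x, |flow u₁ s x - flow u₂ s x| ≤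
      2 * (κ * D) / (r - L) * Real.exp (r * s) := by
    intro s hs x
    refine abs_flow_sub_flow_le h₁ h₂ (by positivity) hrL (fun s hs x => ?_) hs x
    have := C.abs_vel_sub_vel_le (β₁ := β₁) (β₂ := β₂)
      (hw₁.cont.comp (Continuous.prodMk_right s)) (hw₂.cont.comp (Continuous.prodMk_right s))
      (hclose s hs) x
    refine this.trans (le_of_eq ?_)
    ring
  set E := 2 * (κ * D) / (r - L) with hE
  have hE0 : 0 < E := by
    have := sub_pos.2 hrL
    positivity
  have hQE : Q * E ≤ D / 2 := by
    have h1 : r - L = 4 * κ * (Q + 1) := by rw [hr]; ring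
    have h2 : E = D / (2 * (Q + 1)) := by
      rw [hE, h1]
      field_simp
      norm_num
    rw [h2, mul_div_assoc', div_le_div_iff₀ (by positivity) two_pos]
    nlinarith
  have hexpG : ∀ s ∈ Icc 0 t, Real.exp (L * |s|) ≤ G := by
    intro s hs
    rw [abs_of_nonneg hs.1]
    exact Real.exp_le_exp.2 (mul_le_mul_of_nonneg_left (hs.2.trans (ht.2.trans hS)) hL0)
  set e := Real.exp (r * t) with he
  have he0 : 0 < e := Real.exp_pos _
  have hes : ∀ s ∈ Icc 0 t, Real.exp (r * s) ≤ e := fun s hs =>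
    Real.exp_le_exp.2 (mul_le_mul_of_nonneg_left hs.2 (hL0.trans hrL.le))
  set a₁ := flowInv u₁ t z with ha₁
  set a₂ := flowInv u₂ t z with ha₂
  have hA : |a₁ - a₂| ≤ G * (E * e) := by
    refine (h₁.abs_sub_le_flow t a₁ a₂).trans ?_
    refine mul_le_mul (hexpG t ⟨ht.1, le_rfl⟩) ?_ (abs_nonneg _) hG0.le
    have h3 := hX t ht a₂
    rw [h₁.flow_flowInv, abs_sub_comm]
    rwa [h₂.flow_flowInv] at h3
  have hξ : ∀ s ∈ Icc 0 t, |flow u₁ s a₁ - flow u₂ s a₂| ≤ (G * G + 1) * (E * e) := by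
    intro s hs
    have h3 := (h₁.abs_flow_sub_le s a₁ a₂).trans
      (mul_le_mul (hexpG s hs) hA (abs_nonneg _) hG0.le)
    have h4 := (hX s ⟨hs.1, hs.2.trans ht.2⟩ a₂).trans
      (mul_le_mul_of_nonneg_left (hes s hs) hE0.le)
    refine (abs_sub_le _ (flow u₁ s a₂) _).trans ((add_le_add h3 h4).trans (le_of_eq ?_))
    ring
  have hcont : ∀ {u : ℝ → ℝ → ℝ} (_ : IsVelocity L (6 * C.K ^ 2 * M) u) (a : ℝ),
      IntervalIntegrable (fun s => C.χ (flow u s a)) volume 0 t := fun hu a =>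
    (C.continuous_χ.comp (hu.continuous_flow.comp (Continuous.prodMk_left a))).intervalIntegrable _ _
  set I₁ := ∫ s in (0 : ℝ)..t, C.χ (flow u₁ s a₁) with hI₁
  set I₂ := ∫ s in (0 : ℝ)..t, C.χ (flow u₂ s a₂) with hI₂
  have htT : t ≤ T := ht.2.trans hS
  have hI : |I₁ - I₂| ≤ C.K * ((G * G + 1) * (E * e)) * T := by
    rw [hI₁, hI₂, ← intervalIntegral.integral_sub (hcont h₁ a₁) (hcont h₂ a₂)]
    have := intervalIntegral.norm_integral_le_of_norm_le_const (a := 0) (b := t)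
      (f := fun s => C.χ (flow u₁ s a₁) - C.χ (flow u₂ s a₂))
      (C := C.K * ((G * G + 1) * (E * e))) fun s hs => by
        rw [uIoc_of_le ht.1] at hs
        exact (C.χ_bddLip.lip _ _).trans
          (mul_le_mul_of_nonneg_left (hξ s (Ioc_subset_Icc_self hs)) hK.le)
    rw [sub_zero, abs_of_nonneg ht.1] at this
    exact this.trans (mul_le_mul_of_nonneg_left htT (by positivity))
  have hI₁' : |I₁| ≤ C.K * T :=
    (C.abs_integral_χ_le ht.1).trans (mul_le_mul_of_nonneg_left htT hK.le)
  have hsplit : C.transport u₁ f g t z - C.transport u₂ f g t z =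
      (f a₁ - f a₂) + ((g a₁ - g a₂) * I₁ + g a₂ * (I₁ - I₂)) := by
    simp only [transport, ← ha₁, ← ha₂, ← hI₁, ← hI₂]
    ring
  rw [hsplit]
  have t1 : |f a₁ - f a₂| ≤ N * (G * (E * e)) :=
    (hf.lip _ _).trans (mul_le_mul_of_nonneg_left hA hN)
  have t2 : |(g a₁ - g a₂) * I₁| ≤ N * (G * (E * e)) * (C.K * T) := by
    rw [abs_mul]
    exact mul_le_mul ((hg.lip _ _).trans (mul_le_mul_of_nonneg_left hA hN)) hI₁' (abs_nonneg _)
      (by positivity)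
  have t3 : |g a₂ * (I₁ - I₂)| ≤ N * (C.K * ((G * G + 1) * (E * e)) * T) := by
    rw [abs_mul]
    exact mul_le_mul (hg.bdd _) hI (abs_nonneg _) hN
  refine (abs_add_le _ _).trans ((add_le_add t1 ((abs_add_le _ _).trans (add_le_add t2 t3))).trans ?_)
  calc _ = Q * E * e := by rw [hQ]; ring
    _ ≤ D / 2 * e := mul_le_mul_of_nonneg_right hQE he0.le

/-- Projection of time to `[0,T]`. -/
noncomputable def clampTime (T t : ℝ) : ℝ := max 0 (min t T)

lemma continuous_clampTime (T : ℝ) : Continuous (clampTime T) := by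
  unfold clampTime; fun_prop

lemma clampTime_mem {T : ℝ} (hT : 0 ≤ T) (t : ℝ) : clampTime T t ∈ Icc 0 T :=
  ⟨le_max_left _ _, max_le hT (min_le_right _ _)⟩

lemma clampTime_of_mem {T t : ℝ} (ht : t ∈ Icc 0 T) : clampTime T t = t := by
  rw [clampTime, min_eq_left ht.2, max_eq_right ht.1]

/-- Global solvability of the truncated system in Lagrangian form. -/
theorem Cutoff.exists_fixedPoint {c : ℝ} (C : Cutoff c) {β₁ β₂ : ℝ} (hβ₁ : 0 ≤ β₁) (hβ₂ : 0 ≤ β₂)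
    {M N T : ℝ} (hT : 0 ≤ T) (hM : N + N * (C.K * T) ≤ M) {f g : ℝ → ℝ} (hf : BddLip N f)
    (hg : BddLip N g) :
    ∃ w : ℝ → ℝ → ℝ, Adm M w ∧ ∀ t z,
      w t z = C.transport (fun t => C.vel β₁ β₂ (w t)) f g (clampTime T t) z := by
  have hN := hf.nonneg
  have hK := C.K_pos.le
  have hM0 : 0 ≤ M := le_trans (by positivity) hM
  obtain ⟨r, hr, hrate⟩ := C.exists_rate hβ₁ hβ₂ hM0 hN hT
  set τ := clampTime T with hτ
  have hτc : Continuous τ := continuous_clampTime T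
  have hτm := fun t => clampTime_mem hT t
  -- Here h stands for exp(-rτ) w, so the ordinary sup distance of the h's is the weighted distance
  -- halved by `exists_rate`. Clipping at ±M makes `W h` admissible for every h; at the fixed point
  -- `hΨb` shows that the clipping is inactive.
  set W : BoundedContinuousFunction (ℝ × ℝ) ℝ → ℝ → ℝ → ℝ := fun h t x =>
    max (-M) (min M (Real.exp (r * τ t) * h (t, x))) with hW
  have hWadm : ∀ h, Adm M (W h) := fun h => by
    refine ⟨?_, fun t x => abs_le.2 ⟨le_max_left _ _, max_le (by linarith) (min_le_left _ _)⟩⟩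
    have h1 : Continuous fun p : ℝ × ℝ => h (p.1, p.2) := h.continuous
    have h2 : Continuous fun p : ℝ × ℝ => Real.exp (r * τ p.1) :=
      Real.continuous_exp.comp (continuous_const.mul (hτc.comp continuous_fst))
    exact continuous_const.max (continuous_const.min (h2.mul h1))
  set Ψ : BoundedContinuousFunction (ℝ × ℝ) ℝ → ℝ → ℝ → ℝ := fun h =>
    C.transport (fun t => C.vel β₁ β₂ (W h t)) f g with hΨ
  have hΨc : ∀ h, Continuous fun p : ℝ × ℝ => Ψ h p.1 p.2 := fun h =>
    C.continuous_transport (C.isVelocity hβ₁ hβ₂ (hWadm h)) hf.continuous hg.continuous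
  have hΨb : ∀ h, ∀ t ∈ Icc 0 T, ∀ z, |Ψ h t z| ≤ M := fun h t ht z =>
    (C.abs_transport_le hf hg ht.1 z).trans (le_trans (by
      have := mul_le_mul_of_nonneg_left (mul_le_mul_of_nonneg_left ht.2 hK) hN
      linarith) hM)
  have hexp1 : ∀ t, Real.exp (-(r * τ t)) ≤ 1 := fun t =>
    Real.exp_le_one_iff.2 (neg_nonpos.2 (mul_nonneg hr (hτm t).1))
  let Φ : BoundedContinuousFunction (ℝ × ℝ) ℝ → BoundedContinuousFunction (ℝ × ℝ) ℝ := fun h =>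
    BoundedContinuousFunction.ofNormedAddCommGroup
      (fun p : ℝ × ℝ => Real.exp (-(r * τ p.1)) * Ψ h (τ p.1) p.2)
      ((Real.continuous_exp.comp (continuous_const.mul (hτc.comp continuous_fst)).neg).mul
        ((hΨc h).comp ((hτc.comp continuous_fst).prodMk continuous_snd)))
      M (fun p => by
        rw [norm_mul, Real.norm_eq_abs, Real.abs_exp]
        exact (mul_le_mul (hexp1 _) (hΨb h _ (hτm _) _) (abs_nonneg _) zero_le_one).trans
          (one_mul M).le)
  have hΦ : ∀ h p, Φ h p = Real.exp (-(r * τ p.1)) * Ψ h (τ p.1) p.2 := fun _ _ => rfl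
  have hcontr : ContractingWith (1 / 2 : NNReal) Φ := by
    refine ⟨by rw [← NNReal.coe_lt_coe]; norm_num, LipschitzWith.of_dist_le_mul fun h₁ h₂ => ?_⟩
    rcases eq_or_ne h₁ h₂ with rfl | hne
    · simp
    have hD : 0 < dist h₁ h₂ := dist_pos.2 hne
    rw [BoundedContinuousFunction.dist_le (by positivity)]
    intro p
    have hclose : ∀ s ∈ Icc 0 T, ∀ x, |W h₁ s x - W h₂ s x| ≤
        dist h₁ h₂ * Real.exp (r * s) := by
      intro s hs x
      have hs' : τ s = s := clampTime_of_mem hs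
      simp only [hW, hs']
      have e0 := Real.exp_pos (r * s)
      calc _ ≤ |min M (Real.exp (r * s) * h₁ (s, x)) - min M (Real.exp (r * s) * h₂ (s, x))| := by
            rw [max_comm (-M), max_comm (-M)]
            exact abs_max_sub_max_le_abs _ _ _
        _ ≤ |Real.exp (r * s) * h₁ (s, x) - Real.exp (r * s) * h₂ (s, x)| := by
            refine (abs_min_sub_min_le_max _ _ _ _).trans ?_
            simp
        _ = dist (h₁ (s, x)) (h₂ (s, x)) * Real.exp (r * s) := by
            rw [← mul_sub, abs_mul, Real.abs_exp, Real.dist_eq, mul_comm]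
        _ ≤ _ := mul_le_mul_of_nonneg_right (BoundedContinuousFunction.dist_coe_le_dist _) e0.le
    have := hrate f g hf hg (W h₁) (W h₂) (hWadm h₁) (hWadm h₂) T le_rfl _ hD hclose
      (τ p.1) (hτm _) p.2
    rw [Real.dist_eq, hΦ, hΦ, ← mul_sub, abs_mul, Real.abs_exp]
    refine (mul_le_mul_of_nonneg_left this (Real.exp_pos _).le).trans (le_of_eq ?_)
    rw [mul_left_comm, ← Real.exp_add]
    push_cast
    simp
    ring
  obtain ⟨h, hh⟩ : ∃ h, Φ h = h := ⟨_, hcontr.fixedPoint_isFixedPt⟩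
  refine ⟨W h, hWadm h, fun t z => ?_⟩
  have h1 : Real.exp (r * τ t) * h (t, z) = Ψ h (τ t) z := by
    conv_lhs => rw [← hh]
    rw [hΦ, ← mul_assoc, ← Real.exp_add, add_neg_cancel, Real.exp_zero, one_mul]
  have h2 := abs_le.1 (hΨb h _ (hτm t) z)
  change max (-M) (min M (Real.exp (r * τ t) * h (t, z))) = Ψ h (τ t) z
  rw [h1, min_eq_right h2.2, max_eq_right h2.1]

/-- Uniqueness for the truncated system in Lagrangian form. -/
theorem Cutoff.eq_of_fixedPoint {c : ℝ} (C : Cutoff c) {β₁ β₂ : ℝ} (hβ₁ : 0 ≤ β₁) (hβ₂ : 0 ≤ β₂)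
    {M N S : ℝ} {f g : ℝ → ℝ} (hf : BddLip N f) (hg : BddLip N g) {w₁ w₂ : ℝ → ℝ → ℝ}
    (hw₁ : Adm M w₁) (hw₂ : Adm M w₂)
    (h₁ : ∀ t ∈ Icc 0 S, ∀ z, w₁ t z = C.transport (fun t => C.vel β₁ β₂ (w₁ t)) f g t z)
    (h₂ : ∀ t ∈ Icc 0 S, ∀ z, w₂ t z = C.transport (fun t => C.vel β₁ β₂ (w₂ t)) f g t z)
    {t : ℝ} (ht : t ∈ Icc 0 S) (z : ℝ) : w₁ t z = w₂ t z := by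
  have hM := hw₁.nonneg
  obtain ⟨r, hr, hrate⟩ := C.exists_rate hβ₁ hβ₂ hM hf.nonneg (ht.1.trans ht.2)
  -- Each use of the fixed-point equations halves the weighted distance. The start is 2M + 1 rather
  -- than 2M because `exists_rate` asks for a positive distance.
  have key : ∀ k : ℕ, ∀ t ∈ Icc 0 S, ∀ z,
      |w₁ t z - w₂ t z| ≤ (2 * M + 1) / 2 ^ k * Real.exp (r * t) := by
    intro k
    induction k with
    | zero =>
      intro t ht z
      have h1 := abs_le.1 (hw₁.bdd t z)
      have h2 := abs_le.1 (hw₂.bdd t z)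
      have h3 : |w₁ t z - w₂ t z| ≤ 2 * M + 1 := abs_le.2 ⟨by linarith, by linarith⟩
      have h4 : 1 ≤ Real.exp (r * t) := Real.one_le_exp (mul_nonneg hr ht.1)
      rw [pow_zero, div_one]
      nlinarith
    | succ k ih =>
      intro t ht z
      rw [h₁ t ht z, h₂ t ht z]
      refine (hrate f g hf hg w₁ w₂ hw₁ hw₂ S le_rfl _ (by positivity) ih t ht z).trans
        (le_of_eq ?_)
      rw [pow_succ]
      field_simp
  have hlim : Tendsto (fun k : ℕ => (2 * M + 1) / 2 ^ k * Real.exp (r * t)) atTop (𝓝 0) := by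
    have := (tendsto_pow_atTop_nhds_zero_of_lt_one (r := (1 / 2 : ℝ)) (by norm_num)
      (by norm_num)).const_mul ((2 * M + 1) * Real.exp (r * t))
    rw [mul_zero] at this
    refine this.congr fun k => ?_
    rw [one_div, inv_pow]
    ring
  have := ge_of_tendsto' hlim fun k => key k t ht z
  exact sub_eq_zero.1 (abs_nonpos_iff.1 this)

end HouLuoModel

/-! ### Regularity in C([0,T), K^n) and Lagrangian description of solutions -/

namespace HouLuoModel

lemma iteratedDeriv_eq_zero_of_notMem_tsupport {f : ℝ → ℝ} {x : ℝ} (hx : x ∉ tsupport f) (k : ℕ) :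
    iteratedDeriv k f x = 0 := by
  have h : iteratedFDeriv ℝ k f x = 0 := by
    by_contra h
    exact hx (support_iteratedFDeriv_subset k h)
  rw [iteratedDeriv, h]
  rfl

namespace MemK

variable {n : ℕ} {f : ℝ → ℝ}

lemma notMem_tsupport (hf : MemK n f) {x : ℝ} (hx : x ∉ Ioo (0 : ℝ) 1) : x ∉ tsupport f :=
  fun h => hx (hf.2.2 h)

lemma eq_zero (hf : MemK n f) {x : ℝ} (hx : x ∉ Ioo (0 : ℝ) 1) : f x = 0 :=
  image_eq_zero_of_notMem_tsupport (hf.notMem_tsupport hx)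

lemma deriv_eq_zero (hf : MemK n f) {x : ℝ} (hx : x ∉ Ioo (0 : ℝ) 1) : deriv f x = 0 :=
  deriv_of_notMem_tsupport (hf.notMem_tsupport hx)

lemma continuous (hf : MemK n f) : Continuous f := hf.1.continuous

lemma hasDerivAt (hf : MemK n f) (hn : 1 ≤ n) (x : ℝ) : HasDerivAt f (deriv f x) x :=
  (hf.1.differentiable (by exact_mod_cast (by omega : n ≠ 0)) x).hasDerivAt

lemma exists_bddLip (hf : MemK n f) (hn : 1 ≤ n) : ∃ N, BddLip N f :=
  HouLuoModel.exists_bddLip (hf.1.of_le (by exact_mod_cast hn)) hf.2.1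

end MemK

namespace ContK

variable {n : ℕ} {T : ℝ} {f : ℝ → ℝ → ℝ}

/-- The C^n norm sees only (0, 1), but outside this interval all derivatives vanish, so it controls
the difference of two time slices on the whole line. Continuity in x of a single slice does the
rest. -/
lemma continuousOn_iteratedDeriv (hf : ContK n T f) {k : ℕ} (hk : k ≤ n) :
    ContinuousOn (fun p : ℝ × ℝ => iteratedDeriv k (f p.1) p.2) (Ico 0 T ×ˢ univ) := by
  rintro ⟨t, x⟩ ⟨ht, -⟩
  have hmem := hf.mem t ht
  have hle : ∀ s ∈ Ico 0 T, ∀ y, edist (iteratedDeriv k (f s) y) (iteratedDeriv k (f t) y) ≤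
      cNorm n (fun x => f s x - f t x) := by
    intro s hs y
    by_cases hy : y ∈ Ioo (0 : ℝ) 1
    · have h1 : ∀ r ∈ Ico 0 T, ContDiffAt ℝ k (f r) y := fun r hr =>
        ((hf.mem r hr).1.of_le (by exact_mod_cast hk)).contDiffAt
      rw [edist_eq_enorm_sub, ← iteratedDeriv_fun_sub (h1 s hs) (h1 t ht), cNorm]
      refine le_trans ?_ (Finset.single_le_sum (fun _ _ => zero_le)
        (Finset.mem_range.2 (Nat.lt_succ_of_le hk)))
      exact le_iSup₂ (f := fun z (_ : z ∈ Ioo (0 : ℝ) 1) =>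
        ‖iteratedDeriv k (fun x => f s x - f t x) z‖ₑ) y hy
    · rw [iteratedDeriv_eq_zero_of_notMem_tsupport ((hf.mem s hs).notMem_tsupport hy),
        iteratedDeriv_eq_zero_of_notMem_tsupport (hmem.notMem_tsupport hy), edist_self]
      exact zero_le
  have hcont : Continuous (iteratedDeriv k (f t)) :=
    hmem.1.continuous_iteratedDeriv k (by exact_mod_cast hk)
  rw [ContinuousWithinAt, tendsto_iff_edist_tendsto_0]
  have hlim : Tendsto (fun p : ℝ × ℝ => cNorm n (fun x => f p.1 x - f t x) +
      edist (iteratedDeriv k (f t) p.2) (iteratedDeriv k (f t) x))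
      (𝓝[Ico 0 T ×ˢ univ] (t, x)) (𝓝 0) := by
    rw [nhdsWithin_prod_eq, nhdsWithin_univ, ← add_zero (0 : ℝ≥0∞)]
    refine ((hf.cont t ht).comp tendsto_fst).add ?_
    exact (tendsto_iff_edist_tendsto_0.1 (hcont.tendsto x)).comp tendsto_snd
  refine tendsto_of_tendsto_of_tendsto_of_le_of_le' tendsto_const_nhds hlim
    (Eventually.of_forall fun _ => zero_le) ?_
  filter_upwards [self_mem_nhdsWithin] with p hp
  exact (edist_triangle _ (iteratedDeriv k (f t) p.2) _).trans (by gcongr; exact hle _ hp.1 _)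

lemma continuousOn (hf : ContK n T f) :
    ContinuousOn (fun p : ℝ × ℝ => f p.1 p.2) (Ico 0 T ×ˢ univ) := by
  simpa using hf.continuousOn_iteratedDeriv (Nat.zero_le n)

lemma continuousOn_deriv (hf : ContK n T f) (hn : 1 ≤ n) :
    ContinuousOn (fun p : ℝ × ℝ => deriv (f p.1) p.2) (Ico 0 T ×ˢ univ) := by
  simpa using hf.continuousOn_iteratedDeriv hn

lemma exists_lower_bound (hf : ContK n T f) {S : ℝ} (hS : S < T) :
    ∃ c > 0, ∀ t ∈ Icc 0 S, tsupport (f t) ⊆ Ici c := by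
  set B := ⨆ t ∈ Icc 0 S, kNorm n (f t) with hB
  have hBfin : B < ∞ := hf.bdd S hS
  -- The + 1 matters when B = 0: then B⁻¹ = ∞, whose `toReal` would be 0 and no positive bound.
  have hB1 : B + 1 ≠ ∞ := by simp [hBfin.ne]
  refine ⟨((B + 1)⁻¹).toReal, ENNReal.toReal_pos (ENNReal.inv_ne_zero.2 hB1) (by simp), ?_⟩
  intro t ht x hx
  have h1 : (minSupp (f t))⁻¹ ≤ B + 1 :=
    le_self_add.trans' (le_add_self.trans (le_iSup₂ (f := fun t (_ : t ∈ Icc 0 S) =>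
      kNorm n (f t)) t ht))
  have h2 : (B + 1)⁻¹ ≤ ENNReal.ofReal x :=
    (ENNReal.inv_le_iff_inv_le.1 h1).trans (iInf₂_le x hx)
  by_cases hx0 : 0 ≤ x
  · exact ENNReal.toReal_le_of_le_ofReal hx0 h2
  · rw [ENNReal.ofReal_of_nonpos (le_of_not_ge hx0), nonpos_iff_eq_zero] at h2
    exact absurd h2 (ENNReal.inv_ne_zero.2 hB1)

lemma exists_bound (hf : ContK n T f) {S : ℝ} (hS : S < T) :
    ∃ M, ∀ t ∈ Icc 0 S, ∀ x, |f t x| ≤ M := by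
  have hsub : Icc 0 S ×ˢ Icc (0 : ℝ) 1 ⊆ Ico 0 T ×ˢ univ :=
    prod_mono (fun t ht => ⟨ht.1, ht.2.trans_lt hS⟩) (subset_univ _)
  obtain ⟨M, hM⟩ := (isCompact_Icc.prod isCompact_Icc).exists_bound_of_continuousOn
    (hf.continuousOn.mono hsub)
  refine ⟨max M 0, fun t ht x => ?_⟩
  by_cases hx : x ∈ Ioo (0 : ℝ) 1
  · exact (hM (t, x) ⟨ht, Ioo_subset_Icc_self hx⟩).trans (le_max_left _ _)
  · rw [(hf.mem t ⟨ht.1, ht.2.trans_lt hS⟩).eq_zero hx, abs_zero]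
    exact le_max_right _ _

lemma adm_clamp (hf : ContK n T f) {S M : ℝ} (hS0 : 0 ≤ S) (hS : S < T)
    (hM : ∀ t ∈ Icc 0 S, ∀ x, |f t x| ≤ M) : Adm M (fun t => f (clampTime S t)) where
  cont := by
    refine hf.continuousOn.comp_continuous
      (f := fun p : ℝ × ℝ => (clampTime S p.1, p.2)) ?_ ?_
    · exact ((continuous_clampTime S).comp continuous_fst).prodMk continuous_snd
    · exact fun p => ⟨⟨(clampTime_mem hS0 _).1, (clampTime_mem hS0 _).2.trans_lt hS⟩, mem_univ _⟩
  bdd t x := hM _ (clampTime_mem hS0 t) x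

end ContK

/-- The union of the supports of `ω(t)` and `ρ(t)`. -/
def suppU (ω ρ : ℝ → ℝ → ℝ) (t : ℝ) : Set ℝ := tsupport (ω t) ∪ tsupport (ρ t)

lemma eq_zero_of_notMem_suppU {ω ρ : ℝ → ℝ → ℝ} {t x : ℝ} (hx : x ∉ suppU ω ρ t) :
    ω t x = 0 ∧ ρ t x = 0 :=
  ⟨image_eq_zero_of_notMem_tsupport fun h => hx (Or.inl h),
    image_eq_zero_of_notMem_tsupport fun h => hx (Or.inr h)⟩

namespace Cutoff

variable {c : ℝ} (C : Cutoff c)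

lemma χ_mul_eq {w : ℝ → ℝ} (hw : ∀ y, y ∉ Icc c 1 → w y = 0) (y : ℝ) :
    C.χ y * w y = w y / y := by
  by_cases hy : y ∈ Icc c 1
  · rw [C.χ_eq y hy, div_eq_inv_mul]
  · rw [hw y hy, mul_zero, zero_div]

/-- Where χ differs from 1/y the function w vanishes. At the endpoint 1 this follows by continuity
from the right, so the piece of the integral beyond 1 contributes nothing. -/
lemma tail_eq {w : ℝ → ℝ} (hwc : Continuous w) (hw : ∀ y, y ∉ Icc c 1 → w y = 0) (a : ℝ) :
    C.tail w a = ∫ y in (min a 1)..1, w y / y := by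
  have hw1 : ∀ y, 1 ≤ y → C.χ y * w y = 0 := by
    intro y hy
    rcases hy.eq_or_lt with rfl | hy
    · have : w 1 = 0 := by
        have h1 : Tendsto w (𝓝[>] 1) (𝓝 (w 1)) := hwc.continuousAt.tendsto.mono_left nhdsWithin_le_nhds
        refine tendsto_nhds_unique h1 (tendsto_const_nhds.congr' ?_)
        filter_upwards [self_mem_nhdsWithin] with y hy
        exact (hw y fun h => absurd h.2 (not_le.2 hy)).symm
      rw [this, mul_zero]
    · rw [hw y fun h => absurd h.2 (not_le.2 hy), mul_zero]
  simp only [← C.χ_mul_eq hw]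
  have hzero : ∀ a b : ℝ, 1 ≤ a → 1 ≤ b → ∫ y in a..b, C.χ y * w y = 0 := by
    intro a b ha hb
    rw [intervalIntegral.integral_congr (g := fun _ => (0 : ℝ)), intervalIntegral.integral_zero]
    intro y hy
    exact hw1 y ((le_min ha hb).trans hy.1)
  rw [tail, ← intervalIntegral.integral_add_adjacent_intervals (C.intervalIntegrable hwc a 1)
    (C.intervalIntegrable hwc 1 2), hzero 1 2 le_rfl one_le_two, add_zero]
  rcases le_total a 1 with h | h
  · rw [min_eq_left h]
  · rw [min_eq_right h, intervalIntegral.integral_same, hzero a 1 h le_rfl]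

/-- Writing I(a) for the integral of w/y from min(a, 1) to 1, the first integral of the Biot-Savart
law is I(β₂x) - I(β₁x), so the bracket is I(β₂x) - 2 I(β₁x); this explains the form of `vel`. -/
lemma vel_eq_velocity {w : ℝ → ℝ} (hwc : Continuous w) (hw : ∀ y, y ∉ Icc c 1 → w y = 0)
    (β₁ β₂ : ℝ) {x : ℝ} (hx : x ∈ Icc (0 : ℝ) 1) : C.vel β₁ β₂ w x = velocity β₁ β₂ w x := by
  have hint : ∀ a b, IntervalIntegrable (fun y => w y / y) volume a b := fun a b => by
    simpa only [C.χ_mul_eq hw] using C.intervalIntegrable hwc a b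
  rw [vel, velocity, C.θ_eq x hx, C.tail_eq hwc hw, C.tail_eq hwc hw,
    ← intervalIntegral.integral_add_adjacent_intervals (hint (min (β₂ * x) 1) (min (β₁ * x) 1))
      (hint _ 1)]
  ring

end Cutoff

/-- If `b ∘ X = b₀` and `a ∘ X = a₀ + b₀ J`, the homeomorphism `X` transports the supports. -/
lemma tsupport_union_eq_image {a b a₀ b₀ J : ℝ → ℝ} (X : ℝ ≃ₜ ℝ) (hb : ∀ x, b (X x) = b₀ x)
    (ha : ∀ x, a (X x) = a₀ x + b₀ x * J x) :
    tsupport a ∪ tsupport b = X '' (tsupport a₀ ∪ tsupport b₀) := by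
  -- The relation between the pairs is triangular and invertible: (a, b) vanishes at X x exactly
  -- when (a₀, b₀) vanishes at x. The supports taken separately need not correspond.
  simp only [tsupport, ← closure_union]
  rw [X.image_closure]
  congr 1
  ext z
  obtain ⟨x, rfl⟩ := X.surjective z
  rw [X.injective.mem_set_image]
  simp only [mem_union, Function.mem_support, hb, ha]
  by_cases h : b₀ x = 0 <;> simp [h]

/-- The Lagrangian description on `[0,S]` of a solution by the flow of the velocity `u`. -/
structure Chars (β₁ β₂ S L B : ℝ) {c : ℝ} (C : Cutoff c) (u ω ρ : ℝ → ℝ → ℝ) : Prop where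
  vel : IsVelocity L B u
  vel_eq : ∀ t ∈ Icc 0 S, ∀ x ∈ Icc (0 : ℝ) 1, u t x = velocity β₁ β₂ (ω t) x
  rho : ∀ t ∈ Icc 0 S, ∀ x, ρ t (flow u t x) = ρ 0 x
  omega : ∀ t ∈ Icc 0 S, ∀ x,
    ω t (flow u t x) = ω 0 x + ρ 0 x * ∫ s in (0 : ℝ)..t, C.χ (flow u s x)

lemma Chars.suppU_eq {β₁ β₂ S L B c : ℝ} {C : Cutoff c} {u ω ρ : ℝ → ℝ → ℝ}
    (h : Chars β₁ β₂ S L B C u ω ρ) {t : ℝ} (ht : t ∈ Icc 0 S) :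
    suppU ω ρ t = flow u t '' suppU ω ρ 0 :=
  tsupport_union_eq_image (h.vel.flowHomeo t) (h.rho t ht) (h.omega t ht)

section Solution

variable {β₁ β₂ : ℝ} {n : ℕ} {T : ℝ} {ω ρ : ℝ → ℝ → ℝ}

lemma IsSolution.suppU_subset (hsol : IsSolution β₁ β₂ n T ω ρ) {t : ℝ} (ht : t ∈ Ico 0 T) :
    suppU ω ρ t ⊆ Ioo 0 1 :=
  union_subset (hsol.contK_omega.mem t ht).2.2 (hsol.contK_rho.mem t ht).2.2

lemma IsSolution.isCompact_suppU (hsol : IsSolution β₁ β₂ n T ω ρ) {t : ℝ} (ht : t ∈ Ico 0 T) :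
    IsCompact (suppU ω ρ t) :=
  (hsol.contK_omega.mem t ht).2.1.isCompact.union (hsol.contK_rho.mem t ht).2.1.isCompact

lemma IsSolution.exists_lower_bound (hsol : IsSolution β₁ β₂ n T ω ρ) {S : ℝ} (hS : S < T) :
    ∃ c > 0, ∀ t ∈ Icc 0 S, suppU ω ρ t ⊆ Ici c := by
  obtain ⟨c₁, h₁, h₁'⟩ := hsol.contK_omega.exists_lower_bound hS
  obtain ⟨c₂, h₂, h₂'⟩ := hsol.contK_rho.exists_lower_bound hS
  exact ⟨min c₁ c₂, lt_min h₁ h₂, fun t ht => union_subset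
    ((h₁' t ht).trans (Ici_subset_Ici.2 (min_le_left _ _)))
    ((h₂' t ht).trans (Ici_subset_Ici.2 (min_le_right _ _)))⟩

lemma IsSolution.eq_zero_of_notMem (hsol : IsSolution β₁ β₂ n T ω ρ) {c t : ℝ} (ht : t ∈ Ico 0 T)
    (hc : suppU ω ρ t ⊆ Ici c) {x : ℝ} (hx : x ∉ Icc c 1) : ω t x = 0 ∧ ρ t x = 0 :=
  eq_zero_of_notMem_suppU fun h => hx ⟨hc h, (hsol.suppU_subset ht h).2.le⟩

/-- Characteristics of a solution, for any global velocity field that extends its velocity. -/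
lemma IsSolution.chars_of_velocity (hsol : IsSolution β₁ β₂ n T ω ρ) (hn : 1 ≤ n) {S L B c : ℝ}
    (hS : S < T) (C : Cutoff c) (hc : ∀ t ∈ Icc 0 S, suppU ω ρ t ⊆ Ici c) {u : ℝ → ℝ → ℝ}
    (hu : IsVelocity L B u)
    (huv : ∀ t ∈ Icc 0 S, ∀ x ∈ Icc (0 : ℝ) 1, u t x = velocity β₁ β₂ (ω t) x) :
    Chars β₁ β₂ S L B C u ω ρ := by
  have hsubT : Icc 0 S ⊆ Ico 0 T := fun t ht => ⟨ht.1, ht.2.trans_lt hS⟩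
  -- Outside (0, 1) both sides of the equation are zero, so it holds on the whole line with the
  -- global velocity u and orbits need not be confined.
  have hρt : ∀ t ∈ Icc 0 S, ∀ x, HasDerivWithinAt (fun s => ρ s x)
      (-(u t x * deriv (ρ t) x)) (Icc 0 S) t := by
    intro t ht x
    by_cases hx : x ∈ Ioo (0 : ℝ) 1
    · rw [huv t ht x (Ioo_subset_Icc_self hx)]
      exact (hsol.eq_rho t (hsubT ht) x hx).mono hsubT
    · rw [(hsol.contK_rho.mem t (hsubT ht)).deriv_eq_zero hx, mul_zero, neg_zero]
      exact (hasDerivWithinAt_const t (Icc 0 S) (0 : ℝ)).congr_of_mem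
        (fun s hs => (hsol.contK_rho.mem s (hsubT hs)).eq_zero hx) ht
  have hωt : ∀ t ∈ Icc 0 S, ∀ x, HasDerivWithinAt (fun s => ω s x)
      (C.χ x * ρ t x - u t x * deriv (ω t) x) (Icc 0 S) t := by
    intro t ht x
    by_cases hx : x ∈ Ioo (0 : ℝ) 1
    · rw [huv t ht x (Ioo_subset_Icc_self hx), C.χ_mul_eq (w := ρ t)
        fun y hy => (hsol.eq_zero_of_notMem (hsubT ht) (hc t ht) hy).2]
      exact (hsol.eq_omega t (hsubT ht) x hx).mono hsubT
    · rw [(hsol.contK_omega.mem t (hsubT ht)).deriv_eq_zero hx,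
        (hsol.contK_rho.mem t (hsubT ht)).eq_zero hx, mul_zero, mul_zero, sub_zero]
      exact (hasDerivWithinAt_const t (Icc 0 S) (0 : ℝ)).congr_of_mem
        (fun s hs => (hsol.contK_omega.mem s (hsubT hs)).eq_zero hx) ht
  -- Passage from fixed x to the moving point: the variation in x contributes u ∂ₓf, which cancels
  -- the transport term and leaves the source d.
  have along : ∀ {f : ℝ → ℝ → ℝ}, ContK n T f → ∀ x, ∀ t ∈ Icc 0 S, ∀ d,
      HasDerivWithinAt (fun s => f s (flow u t x))
        (d - u t (flow u t x) * deriv (f t) (flow u t x)) (Icc 0 S) t →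
      HasDerivWithinAt (fun s => f s (flow u s x)) d (Icc 0 S) t := by
    intro f hf x t ht d hd
    have h1 := hasDerivWithinAt_sub_frozen (I := Icc 0 S) (f := f) (f' := fun s => deriv (f s))
      (γ := fun s => flow u s x) (t₀ := t) (v := u t (flow u t x))
      (fun s hs y => (hf.mem s (hsubT hs)).hasDerivAt hn y)
      (((hf.continuousOn_deriv hn).mono (prod_mono hsubT subset_rfl)) _ ⟨ht, mem_univ _⟩)
      (hu.hasDerivAt_flow t x).hasDerivWithinAt
    refine ((h1.add hd).congr_deriv (by ring)).congr_of_mem (fun s _ => ?_) ht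
    simp
  have const_of : ∀ {h : ℝ → ℝ}, (∀ t ∈ Icc 0 S, HasDerivWithinAt h 0 (Icc 0 S) t) →
      ∀ t ∈ Icc 0 S, h t = h 0 := by
    intro h hh
    refine constant_of_has_deriv_right_zero (fun t ht => (hh t ht).continuousWithinAt) ?_
    intro t ht
    exact (hh t (Ico_subset_Icc_self ht)).mono_of_mem_nhdsWithin
      (mem_of_superset (Icc_mem_nhdsGE ht.2) (Icc_subset_Icc_left ht.1))
  have hρ : ∀ t ∈ Icc 0 S, ∀ x, ρ t (flow u t x) = ρ 0 x := by
    intro t ht x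
    have := const_of (h := fun s => ρ s (flow u s x)) (fun s hs =>
      along hsol.contK_rho x s hs 0 ((hρt s hs _).congr_deriv (by ring))) t ht
    simpa [hu.flow_zero] using this
  refine ⟨hu, huv, hρ, fun t ht x => ?_⟩
  have hIc : Continuous fun s => C.χ (flow u s x) :=
    C.continuous_χ.comp (hu.continuous_flow.comp (Continuous.prodMk_left x))
  have := const_of (h := fun s => ω s (flow u s x) - ρ 0 x * ∫ r in (0 : ℝ)..s, C.χ (flow u r x))
    (fun s hs => by
      have h1 := along hsol.contK_omega x s hs (C.χ (flow u s x) * ρ s (flow u s x)) (hωt s hs _)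
      have h2 := ((hIc.integral_hasStrictDerivAt 0 s).hasDerivAt.const_mul
        (ρ 0 x)).hasDerivWithinAt (s := Icc 0 S)
      refine (h1.sub h2).congr_deriv ?_
      rw [hρ s hs]
      ring) t ht
  simp only [intervalIntegral.integral_same, mul_zero, sub_zero, hu.flow_zero] at this
  linarith

lemma IsSolution.adm (hsol : IsSolution β₁ β₂ n T ω ρ) {S M : ℝ} (hS0 : 0 ≤ S) (hS : S < T)
    (hM : ∀ t ∈ Icc 0 S, ∀ x, |ω t x| ≤ M) : Adm M (fun t => ω (clampTime S t)) :=
  hsol.contK_omega.adm_clamp hS0 hS hM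

lemma IsSolution.vel_eq (hsol : IsSolution β₁ β₂ n T ω ρ) {c t : ℝ} (C : Cutoff c)
    (ht : t ∈ Ico 0 T) (hc : suppU ω ρ t ⊆ Ici c) {x : ℝ} (hx : x ∈ Icc (0 : ℝ) 1) :
    C.vel β₁ β₂ (ω t) x = velocity β₁ β₂ (ω t) x :=
  C.vel_eq_velocity (hsol.contK_omega.mem t ht).continuous
    (fun _ hy => (hsol.eq_zero_of_notMem ht hc hy).1) β₁ β₂ hx

/-- Characteristics of a solution on `[0,S]`. -/
lemma IsSolution.chars (hsol : IsSolution β₁ β₂ n T ω ρ) (hn : 1 ≤ n) (hβ₁ : 0 ≤ β₁)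
    (hβ₂ : 0 ≤ β₂) {S M c : ℝ} (hS0 : 0 ≤ S) (hS : S < T) (C : Cutoff c)
    (hc : ∀ t ∈ Icc 0 S, suppU ω ρ t ⊆ Ici c) (hM : ∀ t ∈ Icc 0 S, ∀ x, |ω t x| ≤ M) :
    Chars β₁ β₂ S (C.lipConst β₁ β₂ M) (6 * C.K ^ 2 * M) C
      (fun t => C.vel β₁ β₂ (ω (clampTime S t))) ω ρ := by
  refine hsol.chars_of_velocity hn hS C hc (C.isVelocity hβ₁ hβ₂ (hsol.adm hS0 hS hM)) ?_
  intro t ht x hx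
  simp only [clampTime_of_mem ht]
  exact hsol.vel_eq C ⟨ht.1, ht.2.trans_lt hS⟩ (hc t ht) hx

lemma IsSolution.exists_chars (hsol : IsSolution β₁ β₂ n T ω ρ) (hn : 1 ≤ n) (hβ₁ : 0 ≤ β₁)
    (hβ₂ : 0 ≤ β₂) {S : ℝ} (hS0 : 0 ≤ S) (hS : S < T) :
    ∃ c > 0, ∃ (C : Cutoff c) (L B : ℝ) (u : ℝ → ℝ → ℝ),
      (∀ t ∈ Icc 0 S, suppU ω ρ t ⊆ Ici c) ∧ Chars β₁ β₂ S L B C u ω ρ := by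
  obtain ⟨c, hc0, hc⟩ := hsol.exists_lower_bound hS
  obtain ⟨C⟩ := nonempty_cutoff hc0
  obtain ⟨M, hM⟩ := hsol.contK_omega.exists_bound hS
  exact ⟨c, hc0, C, _, _, _, hc, hsol.chars hn hβ₁ hβ₂ hS0 hS C hc hM⟩

end Solution

end HouLuoModel

/-! ### Integral criteria and the distance of the supports from 0 -/

namespace HouLuoModel

/-- For a continuous function the essential supremum bounds every value, because an open set where
it is exceeded would have positive measure. -/
lemma enorm_le_supNorm {f : ℝ → ℝ} (hf : ContinuousOn f (Ioo 0 1)) {x : ℝ}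
    (hx : x ∈ Ioo (0 : ℝ) 1) : ‖f x‖ₑ ≤ supNorm f := by
  by_contra hcon
  push Not at hcon
  have hopen : IsOpen (Ioo (0 : ℝ) 1 ∩ (fun y => ‖f y‖ₑ) ⁻¹' Ioi (supNorm f)) :=
    (continuous_enorm.comp_continuousOn hf).isOpen_inter_preimage isOpen_Ioo isOpen_Ioi
  have hpos := hopen.measure_pos volume ⟨x, hx, hcon⟩
  have hae : ∀ᵐ y ∂(volume.restrict (Ioo (0 : ℝ) 1)), ‖f y‖ₑ ≤ supNorm f := by
    simp only [supNorm, eLpNorm_exponent_top]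
    exact ae_le_eLpNormEssSup
  rw [ae_restrict_iff' measurableSet_Ioo, ae_iff] at hae
  refine hpos.ne' (measure_mono_null (fun y hy => ?_) hae)
  simp only [mem_ofPred_eq, not_forall, not_le]
  exact ⟨hy.1, hy.2⟩

lemma supNorm_le {f : ℝ → ℝ} {M : ℝ} (h : ∀ x ∈ Ioo (0 : ℝ) 1, |f x| ≤ M) :
    supNorm f ≤ ENNReal.ofReal M := by
  simp only [supNorm, eLpNorm_exponent_top]
  exact eLpNormEssSup_le_of_ae_bound ((ae_restrict_iff' measurableSet_Ioo).2
    (Eventually.of_forall h))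

lemma lintegral_lt_top_of_le {T M : ℝ} {F : ℝ → ℝ≥0∞}
    (h : ∀ t ∈ Ico 0 T, F t ≤ ENNReal.ofReal M) : (∫⁻ t in Ioo 0 T, F t) < ∞ := by
  refine (setLIntegral_mono' measurableSet_Ioo fun t ht => h t (Ioo_subset_Ico_self ht)).trans_lt ?_
  rw [setLIntegral_const]
  exact ENNReal.mul_lt_top ENNReal.ofReal_lt_top (by simp)

/-- The supports stay uniformly away from `0` on `[0,T)`. -/
def SuppBddBelow (T : ℝ) (ω ρ : ℝ → ℝ → ℝ) : Prop :=
  ∃ c > 0, ∀ t ∈ Ico 0 T, suppU ω ρ t ⊆ Ici c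

section Solution

variable {β₁ β₂ : ℝ} {n : ℕ} {T : ℝ} {ω ρ : ℝ → ℝ → ℝ}

/-- The liminf controls only times close to T. The remaining times form a compact subinterval of [0,
T), where boundedness of the K^n norm supplies a lower bound. -/
lemma IsSolution.suppBddBelow_iff (hsol : IsSolution β₁ β₂ n T ω ρ) (hT : 0 < T) :
    SuppBddBelow T ω ρ ↔ 0 < liminf (delta ω ρ) (𝓝[<] T) := by
  constructor
  · rintro ⟨c, hc, h⟩
    refine (ENNReal.ofReal_pos.2 hc).trans_le (le_liminf_of_le (by isBoundedDefault) ?_)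
    filter_upwards [Ioo_mem_nhdsLT hT] with t ht
    exact le_iInf₂ fun x hx => ENNReal.ofReal_le_ofReal (h t (Ioo_subset_Ico_self ht) hx)
  · intro h
    obtain ⟨a, ha0, ha⟩ := exists_between h
    have hev := eventually_lt_of_lt_liminf ha (by isBoundedDefault)
    obtain ⟨S, hS, hST⟩ := (mem_nhdsLT_iff_exists_Ioo_subset' hT).1 hev
    obtain ⟨c, hc0, hc⟩ := hsol.exists_lower_bound (S := S) hS
    refine ⟨min c a.toReal, lt_min hc0 (ENNReal.toReal_pos ha0.ne' ha.ne_top), fun t ht x hx => ?_⟩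
    rcases le_or_gt t S with h | h
    · exact (min_le_left _ _).trans (mem_Ici.1 (hc t ⟨ht.1, h⟩ hx))
    · have h1 : a < delta ω ρ t := hST ⟨h, ht.2⟩
      have h2 : delta ω ρ t ≤ ENNReal.ofReal x := iInf₂_le x hx
      exact (min_le_right _ _).trans (ENNReal.toReal_le_of_le_ofReal
        (hsol.suppU_subset ht hx).1.le (h1.le.trans h2))

lemma IsSolution.suppU_eq_empty (hsol : IsSolution β₁ β₂ n T ω ρ) (hn : 1 ≤ n) (hβ₁ : 0 ≤ β₁)
    (hβ₂ : 0 ≤ β₂) (h0 : suppU ω ρ 0 = ∅) {t : ℝ} (ht : t ∈ Ico 0 T) : suppU ω ρ t = ∅ := by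
  obtain ⟨c, -, C, L, B, u, -, hch⟩ := hsol.exists_chars hn hβ₁ hβ₂ ht.1 ht.2
  rw [hch.suppU_eq ⟨ht.1, le_rfl⟩, h0, image_empty]

/-- The flow map is increasing, so extreme points go to extreme points. The evolution of the
distance to 0 thereby becomes an ODE for one orbit. -/
lemma Chars.isLeast {S L B c : ℝ} {C : Cutoff c} {u : ℝ → ℝ → ℝ}
    (h : Chars β₁ β₂ S L B C u ω ρ) {q : ℝ} (hq : IsLeast (suppU ω ρ 0) q) {t : ℝ}
    (ht : t ∈ Icc 0 S) : IsLeast (suppU ω ρ t) (flow u t q) := by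
  rw [h.suppU_eq ht]
  exact (h.vel.strictMono_flow t).monotone.map_isLeast hq

lemma Chars.isGreatest {S L B c : ℝ} {C : Cutoff c} {u : ℝ → ℝ → ℝ}
    (h : Chars β₁ β₂ S L B C u ω ρ) {q : ℝ} (hq : IsGreatest (suppU ω ρ 0) q) {t : ℝ}
    (ht : t ∈ Icc 0 S) : IsGreatest (suppU ω ρ t) (flow u t q) := by
  rw [h.suppU_eq ht]
  exact (h.vel.strictMono_flow t).monotone.map_isGreatest hq

/-- A lower bound for the orbit of the smallest point of the initial support suffices. -/
lemma IsSolution.suppBddBelow_of_flow (hsol : IsSolution β₁ β₂ n T ω ρ) (hn : 1 ≤ n)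
    (hβ₁ : 0 ≤ β₁) (hβ₂ : 0 ≤ β₂) (hT : 0 < T)
    (h : ∀ q, IsLeast (suppU ω ρ 0) q → ∃ d > 0, ∀ S ∈ Ico 0 T, ∀ (c : ℝ) (C : Cutoff c)
      (L B : ℝ) (u : ℝ → ℝ → ℝ), (∀ t ∈ Icc 0 S, suppU ω ρ t ⊆ Ici c) →
      Chars β₁ β₂ S L B C u ω ρ → d ≤ flow u S q) :
    SuppBddBelow T ω ρ := by
  rcases (suppU ω ρ 0).eq_empty_or_nonempty with h0 | h0
  · exact ⟨1, one_pos, fun t ht => by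
      rw [hsol.suppU_eq_empty hn hβ₁ hβ₂ h0 ht]; exact empty_subset _⟩
  · obtain ⟨q, hq⟩ := (hsol.isCompact_suppU ⟨le_rfl, hT⟩).exists_isLeast h0
    obtain ⟨d, hd, hd'⟩ := h q hq
    refine ⟨d, hd, fun t ht x hx => ?_⟩
    obtain ⟨c, -, C, L, B, u, hc, hch⟩ := hsol.exists_chars hn hβ₁ hβ₂ ht.1 ht.2
    exact (hd' t ht c C L B u hc hch).trans ((hch.isLeast hq ⟨ht.1, le_rfl⟩).2 hx)

lemma Cutoff.contDiff_vel {c : ℝ} (C : Cutoff c) {w : ℝ → ℝ} (hw : Continuous w) :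
    ContDiff ℝ 1 (C.vel β₁ β₂ w) := by
  have h : JointC 0 (fun _ : ℝ => w) := hw.comp continuous_snd
  exact_mod_cast (C.jointC_vel (β₁ := β₁) (β₂ := β₂) h).contDiff 0

lemma IsSolution.deriv_velocity_eq (hsol : IsSolution β₁ β₂ n T ω ρ) {c t : ℝ} (C : Cutoff c)
    (ht : t ∈ Ico 0 T) (hc : suppU ω ρ t ⊆ Ici c) {x : ℝ} (hx : x ∈ Ioo (0 : ℝ) 1) :
    deriv (velocity β₁ β₂ (ω t)) x = deriv (C.vel β₁ β₂ (ω t)) x := by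
  refine EventuallyEq.deriv_eq ?_
  filter_upwards [isOpen_Ioo.mem_nhds hx] with y hy
  exact (hsol.vel_eq C ht hc (Ioo_subset_Icc_self hy)).symm

/-- Mean value theorem between 0, where the velocity vanishes, and x. It is applied to the truncated
velocity, which is C¹ on the whole line and coincides with the true one on [0, 1]. -/
lemma IsSolution.enorm_velocity_div_le (hsol : IsSolution β₁ β₂ n T ω ρ) {c t : ℝ} (C : Cutoff c)
    (ht : t ∈ Ico 0 T) (hc : suppU ω ρ t ⊆ Ici c) {x : ℝ} (hx : x ∈ Ioo (0 : ℝ) 1) :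
    ‖velocity β₁ β₂ (ω t) x / x‖ₑ ≤ supNorm (deriv (velocity β₁ β₂ (ω t))) := by
  have hC := C.contDiff_vel (β₁ := β₁) (β₂ := β₂) (hsol.contK_omega.mem t ht).continuous
  obtain ⟨η, hη, hη'⟩ := exists_deriv_eq_slope (C.vel β₁ β₂ (ω t)) hx.1 hC.continuous.continuousOn
    (hC.differentiable one_ne_zero).differentiableOn
  have hη1 : η ∈ Ioo (0 : ℝ) 1 := ⟨hη.1, hη.2.trans hx.2⟩
  have h0 : C.vel β₁ β₂ (ω t) 0 = 0 := by rw [Cutoff.vel, C.θ_eq 0 ⟨le_rfl, zero_le_one⟩, zero_mul]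
  rw [h0, sub_zero, sub_zero, hsol.vel_eq C ht hc (Ioo_subset_Icc_self hx),
    ← hsol.deriv_velocity_eq C ht hc hη1] at hη'
  rw [← hη']
  refine enorm_le_supNorm ?_ hη1
  exact (hC.continuous_deriv le_rfl).continuousOn.congr fun y hy => hsol.deriv_velocity_eq C ht hc hy

/-- Integrability of `‖∂ₓu‖` keeps the supports away from `0`. -/
lemma IsSolution.suppBddBelow_of_velocity (hsol : IsSolution β₁ β₂ n T ω ρ) (hn : 1 ≤ n)
    (hβ₁ : 0 ≤ β₁) (hβ₂ : 0 ≤ β₂) (hT : 0 < T)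
    (h : (∫⁻ t in Ioo 0 T, supNorm (deriv (velocity β₁ β₂ (ω t)))) < ∞) :
    SuppBddBelow T ω ρ := by
  refine hsol.suppBddBelow_of_flow hn hβ₁ hβ₂ hT fun q hq => ?_
  set I := (∫⁻ t in Ioo 0 T, supNorm (deriv (velocity β₁ β₂ (ω t)))).toReal with hI
  refine ⟨Real.exp (Real.log q - I), Real.exp_pos _, fun S hS c C L B u hc hch => ?_⟩
  have hu := hch.vel
  have hmem : ∀ t ∈ Icc 0 S, flow u t q ∈ Ioo (0 : ℝ) 1 := fun t ht =>
    hsol.suppU_subset ⟨ht.1, ht.2.trans_lt hS.2⟩ (hch.isLeast hq ht).1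
  have hqc : Continuous fun t => flow u t q := hu.continuous_flow.comp (Continuous.prodMk_left q)
  -- The logarithm of the orbit has derivative u/X, bounded by ‖∂ₓu‖; its total variation is thus at
  -- most the integral I.
  have key := abs_sub_le_toReal_lintegral (S := S) (T := T) hS.2.le
    (f := fun t => Real.log (flow u t q)) (f' := fun t => u t (flow u t q) / flow u t q)
    (fun t ht => ((hu.hasDerivAt_flow t q).log (hmem t ht).1.ne').hasDerivWithinAt)
    ((hu.cont.comp (continuous_id.prodMk hqc)).continuousOn.div hqc.continuousOn
      fun t ht => (hmem t ht).1.ne')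
    (fun t ht => by
      rw [hch.vel_eq t ht _ (Ioo_subset_Icc_self (hmem t ht))]
      exact hsol.enorm_velocity_div_le C ⟨ht.1, ht.2.trans_lt hS.2⟩ (hc t ht) (hmem t ht))
    h (t := S) ⟨hS.1, le_rfl⟩
  simp only [hu.flow_zero] at key
  rw [← Real.le_log_iff_exp_le (hmem S ⟨hS.1, le_rfl⟩).1]
  linarith [(abs_le.1 key).1]

/-- Integrability of `‖∂ₓρ‖` bounds `ω`. -/
lemma IsSolution.lintegral_omega_of_rho (hsol : IsSolution β₁ β₂ n T ω ρ) (hn : 1 ≤ n)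
    (hβ₁ : 0 ≤ β₁) (hβ₂ : 0 ≤ β₂) (hT : 0 < T)
    (h : (∫⁻ t in Ioo 0 T, supNorm (deriv (ρ t))) < ∞) :
    (∫⁻ t in Ioo 0 T, supNorm (ω t)) < ∞ := by
  set I := (∫⁻ t in Ioo 0 T, supNorm (deriv (ρ t))).toReal with hI
  obtain ⟨N, hN⟩ := (hsol.contK_omega.mem 0 ⟨le_rfl, hT⟩).exists_bddLip hn
  refine lintegral_lt_top_of_le (M := N + I) fun S hS => supNorm_le fun z _ => ?_
  obtain ⟨c, -, C, L, B, u, hc, hch⟩ := hsol.exists_chars hn hβ₁ hβ₂ hS.1 hS.2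
  have hu := hch.vel
  obtain ⟨x, rfl⟩ := hu.surjective_flow S z
  have hIc : Continuous fun s => C.χ (flow u s x) :=
    C.continuous_χ.comp (hu.continuous_flow.comp (Continuous.prodMk_left x))
  -- The function followed is ω along the orbit of x. Its derivative is ρ/X at the moving point, and
  -- ρ vanishes at 0, so the mean value theorem bounds it by ‖∂ₓρ‖.
  have key := abs_sub_le_toReal_lintegral (S := S) (T := T) hS.2.le
    (f := fun t => ω 0 x + ρ 0 x * ∫ s in (0 : ℝ)..t, C.χ (flow u s x))
    (f' := fun t => ρ 0 x * C.χ (flow u t x))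
    (fun t _ => (((hIc.integral_hasStrictDerivAt 0 t).hasDerivAt.const_mul
      (ρ 0 x)).const_add (ω 0 x)).hasDerivWithinAt)
    (continuous_const.mul hIc).continuousOn
    (fun t ht => by
      have htT : t ∈ Ico 0 T := ⟨ht.1, ht.2.trans_lt hS.2⟩
      have hρ := hsol.contK_rho.mem t htT
      rw [← hch.rho t ht x, mul_comm, C.χ_mul_eq (w := ρ t)
        fun y hy => (hsol.eq_zero_of_notMem htT (hc t ht) hy).2]
      by_cases hx : flow u t x ∈ Ioo (0 : ℝ) 1
      · obtain ⟨η, hη, hη'⟩ := exists_hasDerivAt_eq_slope (ρ t) (deriv (ρ t)) hx.1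
          hρ.continuous.continuousOn (fun y _ => hρ.hasDerivAt hn y)
        rw [hρ.eq_zero (x := 0) (by simp), sub_zero, sub_zero] at hη'
        rw [← hη']
        exact enorm_le_supNorm (hρ.1.continuous_deriv (by exact_mod_cast hn)).continuousOn
          ⟨hη.1, hη.2.trans hx.2⟩
      · simp [hρ.eq_zero hx])
    h (t := S) ⟨hS.1, le_rfl⟩
  rw [← hch.omega S ⟨hS.1, le_rfl⟩ x, intervalIntegral.integral_same, mul_zero, add_zero] at key
  have h1 := abs_le.1 key
  have h2 := abs_le.1 (hN.bdd x)
  exact abs_le.2 ⟨by linarith, by linarith⟩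

/-- The logarithmic bound on the truncated tail integral. -/
lemma Cutoff.abs_tail_le_log {c : ℝ} (C : Cutoff c) {w : ℝ → ℝ} (hwc : Continuous w) {q N : ℝ}
    (hq0 : 0 < q) (hq1 : q ≤ 1) (hcq : c ≤ q) (hw : ∀ y, y ∉ Icc q 1 → w y = 0)
    (hN : ∀ y, |w y| ≤ N) (a : ℝ) : |C.tail w a| ≤ N * -Real.log q := by
  have hN0 : 0 ≤ N := (abs_nonneg _).trans (hN 0)
  have hwz : ∀ y ≤ q, w y = 0 := by
    have h1 : closure (Iio q) ⊆ {y | w y = 0} :=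
      closure_minimal (fun y hy => hw y fun h => absurd h.1 (not_le.2 hy))
        (isClosed_eq hwc continuous_const)
    rw [closure_Iio] at h1
    exact fun y hy => h1 hy
  have hw' : ∀ y, y ∉ Icc c 1 → w y = 0 := fun y hy => hw y fun h => hy ⟨hcq.trans h.1, h.2⟩
  have key : ∀ a, q ≤ a → |C.tail w a| ≤ N * -Real.log q := by
    intro a ha
    rw [C.tail_eq hwc hw']
    set m := min a 1 with hm
    have hqm : q ≤ m := le_min ha hq1
    have hm0 : 0 < m := hq0.trans_le hqm
    have hm1 : m ≤ 1 := min_le_right _ _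
    have hinv : IntervalIntegrable (fun y => N * y⁻¹) volume m 1 := by
      refine ContinuousOn.intervalIntegrable ?_
      rw [uIcc_of_le hm1]
      exact continuousOn_const.mul (continuousOn_inv₀.mono fun y hy => (hm0.trans_le hy.1).ne')
    have h1 := intervalIntegral.norm_integral_le_of_norm_le (f := fun y => w y / y) hm1
      (Eventually.of_forall fun y hy => by
        have hy0 : 0 < y := hm0.trans hy.1
        rw [norm_div, Real.norm_eq_abs, Real.norm_eq_abs, abs_of_pos hy0, div_eq_mul_inv]
        exact mul_le_mul_of_nonneg_right (hN y) (inv_nonneg.2 hy0.le)) hinv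
    rw [intervalIntegral.integral_const_mul, integral_inv_of_pos hm0 one_pos, one_div,
      Real.log_inv] at h1
    exact h1.trans (mul_le_mul_of_nonneg_left (neg_le_neg (Real.log_le_log hq0 hqm)) hN0)
  rcases le_total q a with h | h
  · exact key a h
  · have h1 := C.tail_sub_tail hwc a q
    rw [intervalIntegral.integral_congr (g := fun _ => (0 : ℝ)), intervalIntegral.integral_zero,
      sub_eq_zero] at h1
    · rw [h1]
      exact key q le_rfl
    · intro y hy
      rw [uIcc_of_le h] at hy
      simp [hwz y hy.2]

/-- The 3 is the total weight 1 + 2 of the two tails in the velocity. The modulus q log(1/q)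
satisfies the Osgood condition, so a bound on ω prevents the least point of the support from
reaching 0. -/
lemma Cutoff.abs_vel_le_log {c : ℝ} (C : Cutoff c) {w : ℝ → ℝ} (hwc : Continuous w) {q N : ℝ}
    (hq0 : 0 < q) (hq1 : q ≤ 1) (hcq : c ≤ q) (hw : ∀ y, y ∉ Icc q 1 → w y = 0)
    (hN : ∀ y, |w y| ≤ N) : |C.vel β₁ β₂ w q| ≤ 3 * N * (q * -Real.log q) := by
  have h1 := abs_le.1 (C.abs_tail_le_log hwc hq0 hq1 hcq hw hN (β₂ * q))
  have h2 := abs_le.1 (C.abs_tail_le_log hwc hq0 hq1 hcq hw hN (β₁ * q))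
  rw [Cutoff.vel, C.θ_eq q ⟨hq0.le, hq1⟩, abs_mul, abs_of_pos hq0]
  have h3 : |C.tail w (β₂ * q) - 2 * C.tail w (β₁ * q)| ≤ 3 * (N * -Real.log q) :=
    abs_le.2 ⟨by linarith [h1.1, h2.2], by linarith [h1.2, h2.1]⟩
  refine (mul_le_mul_of_nonneg_left h3 hq0.le).trans (le_of_eq ?_)
  ring

/-- Integrability of `‖ω‖` keeps the supports away from `0`. -/
lemma IsSolution.suppBddBelow_of_omega (hsol : IsSolution β₁ β₂ n T ω ρ) (hn : 1 ≤ n)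
    (hβ₁ : 0 ≤ β₁) (hβ₂ : 0 ≤ β₂) (hT : 0 < T)
    (h : (∫⁻ t in Ioo 0 T, supNorm (ω t)) < ∞) : SuppBddBelow T ω ρ := by
  refine hsol.suppBddBelow_of_flow hn hβ₁ hβ₂ hT fun q hq => ?_
  have h3 : (∫⁻ t in Ioo 0 T, 3 * supNorm (ω t)) < ∞ := by
    rw [lintegral_const_mul' _ _ (by simp)]
    exact ENNReal.mul_lt_top (by simp) h
  set I := (∫⁻ t in Ioo 0 T, 3 * supNorm (ω t)).toReal with hI
  refine ⟨Real.exp (-Real.exp (Real.log (-Real.log q) + I)), Real.exp_pos _,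
    fun S hS c C L B u hc hch => ?_⟩
  have hu := hch.vel
  have hmem : ∀ t ∈ Icc 0 S, flow u t q ∈ Ioo (0 : ℝ) 1 := fun t ht =>
    hsol.suppU_subset ⟨ht.1, ht.2.trans_lt hS.2⟩ (hch.isLeast hq ht).1
  have hlog : ∀ t ∈ Icc 0 S, 0 < -Real.log (flow u t q) := fun t ht =>
    neg_pos.2 (Real.log_neg (hmem t ht).1 (hmem t ht).2)
  have hqc : Continuous fun t => flow u t q := hu.continuous_flow.comp (Continuous.prodMk_left q)
  have hS' : S ∈ Icc 0 S := ⟨hS.1, le_rfl⟩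
  -- With |X'| ≤ 3‖ω‖ X log(1/X), the quantity log log(1/X) has derivative at most 3‖ω‖ in absolute
  -- value. Undoing the two logarithms gives the double exponential chosen above.
  have key := abs_sub_le_toReal_lintegral (S := S) (T := T) hS.2.le
    (f := fun t => Real.log (-Real.log (flow u t q)))
    (f' := fun t => -(u t (flow u t q) / flow u t q) / -Real.log (flow u t q))
    (fun t ht => ((((hu.hasDerivAt_flow t q).log (hmem t ht).1.ne').neg).log
      (hlog t ht).ne').hasDerivWithinAt)
    ((((hu.cont.comp (continuous_id.prodMk hqc)).continuousOn.div hqc.continuousOn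
      fun t ht => (hmem t ht).1.ne').neg).div
        ((hqc.continuousOn.log fun t ht => (hmem t ht).1.ne').neg) fun t ht => (hlog t ht).ne')
    (fun t ht => by
      have htT : t ∈ Ico 0 T := ⟨ht.1, ht.2.trans_lt hS.2⟩
      have hω := hsol.contK_omega.mem t htT
      have hfin : supNorm (ω t) ≠ ∞ := by
        obtain ⟨M, hM⟩ := hω.exists_bddLip hn
        exact ((supNorm_le fun x _ => hM.bdd x).trans_lt ENNReal.ofReal_lt_top).ne
      set N := (supNorm (ω t)).toReal with hN
      have hNb : ∀ y, |ω t y| ≤ N := by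
        intro y
        by_cases hy : y ∈ Ioo (0 : ℝ) 1
        · have := ENNReal.toReal_mono hfin (enorm_le_supNorm hω.continuous.continuousOn hy)
          rwa [toReal_enorm, Real.norm_eq_abs] at this
        · rw [hω.eq_zero hy, abs_zero]
          exact ENNReal.toReal_nonneg
      have hleast := hch.isLeast hq ht
      have hv := C.abs_vel_le_log (β₁ := β₁) (β₂ := β₂) hω.continuous (hmem t ht).1
        (hmem t ht).2.le (hc t ht hleast.1)
        (fun y hy => (hsol.eq_zero_of_notMem htT (fun x hx => hleast.2 hx) hy).1) hNb
      rw [hch.vel_eq t ht _ (Ioo_subset_Icc_self (hmem t ht)),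
        ← hsol.vel_eq C htT (hc t ht) (Ioo_subset_Icc_self (hmem t ht))]
      have h5 : ‖-(C.vel β₁ β₂ (ω t) (flow u t q) / flow u t q) / -Real.log (flow u t q)‖ ≤
          3 * N := by
        rw [norm_div, norm_neg, norm_div, Real.norm_eq_abs, Real.norm_eq_abs, Real.norm_eq_abs,
          abs_of_pos (hmem t ht).1, abs_of_pos (hlog t ht), div_div,
          div_le_iff₀ (mul_pos (hmem t ht).1 (hlog t ht))]
        exact hv
      rw [← ofReal_norm]
      refine (ENNReal.ofReal_le_ofReal h5).trans (le_of_eq ?_)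
      rw [ENNReal.ofReal_mul (by norm_num), hN, ENNReal.ofReal_toReal hfin]
      simp)
    h3 (t := S) hS'
  simp only [hu.flow_zero] at key
  rw [← Real.le_log_iff_exp_le (hmem S hS').1, neg_le, ← Real.log_le_iff_le_exp (hlog S hS')]
  linarith [(abs_le.1 key).2]

/-- If the supports stay away from `0`, then `ω` is bounded up to time `T`. -/
lemma IsSolution.abs_omega_le (hsol : IsSolution β₁ β₂ n T ω ρ) (hn : 1 ≤ n)
    (hβ₁ : 0 ≤ β₁) (hβ₂ : 0 ≤ β₂) {c N : ℝ} (C : Cutoff c)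
    (hc : ∀ t ∈ Ico 0 T, suppU ω ρ t ⊆ Ici c) (hω : BddLip N (ω 0)) (hρ : BddLip N (ρ 0))
    {t : ℝ} (ht : t ∈ Ico 0 T) (z : ℝ) : |ω t z| ≤ N + N * (C.K * T) := by
  obtain ⟨M, hM⟩ := hsol.contK_omega.exists_bound ht.2
  have hch := hsol.chars hn hβ₁ hβ₂ ht.1 ht.2 C
    (fun s hs => hc s ⟨hs.1, hs.2.trans_lt ht.2⟩) hM
  obtain ⟨x, rfl⟩ := hch.vel.surjective_flow t z
  rw [hch.omega t ⟨ht.1, le_rfl⟩]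
  refine (abs_add_le _ _).trans (add_le_add (hω.bdd x) ?_)
  rw [abs_mul]
  exact mul_le_mul (hρ.bdd x) ((C.abs_integral_χ_le ht.1).trans
    (mul_le_mul_of_nonneg_left ht.2.le C.K_pos.le)) (abs_nonneg _) hω.nonneg

/-- If the supports stay away from `0`, all three norms are bounded. -/
lemma IsSolution.lintegrals_of_suppBddBelow (hsol : IsSolution β₁ β₂ n T ω ρ) (hn : 1 ≤ n)
    (hβ₁ : 0 ≤ β₁) (hβ₂ : 0 ≤ β₂) (hT : 0 < T) (h : SuppBddBelow T ω ρ) :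
    (∫⁻ t in Ioo 0 T, supNorm (deriv (velocity β₁ β₂ (ω t)))) < ∞ ∧
    (∫⁻ t in Ioo 0 T, supNorm (deriv (ρ t))) < ∞ ∧
    (∫⁻ t in Ioo 0 T, supNorm (ω t)) < ∞ := by
  obtain ⟨c, hc0, hc⟩ := h
  obtain ⟨C⟩ := nonempty_cutoff hc0
  obtain ⟨N₁, hN₁⟩ := (hsol.contK_omega.mem 0 ⟨le_rfl, hT⟩).exists_bddLip hn
  obtain ⟨N₂, hN₂⟩ := (hsol.contK_rho.mem 0 ⟨le_rfl, hT⟩).exists_bddLip hn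
  set N := max N₁ N₂ with hN
  have hω := hN₁.mono (le_max_left N₁ N₂)
  have hρ := hN₂.mono (le_max_right N₁ N₂)
  set M := N + N * (C.K * T) with hM
  have hb : ∀ t ∈ Ico 0 T, ∀ z, |ω t z| ≤ M := fun t ht z =>
    hsol.abs_omega_le hn hβ₁ hβ₂ C hc hω hρ ht z
  set L := C.lipConst β₁ β₂ M with hL
  have hsub : ∀ {t}, t ∈ Ico 0 T → Icc 0 t ⊆ Ico 0 T := fun ht s hs =>
    ⟨hs.1, hs.2.trans_lt ht.2⟩
  -- All bounds are uniform in t < T: ∂ₓu is at most the Lipschitz constant of the truncated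
  -- velocity, and ρ(t) is the initial density composed with an inverse flow of Lipschitz constant
  -- at most exp(LT).
  refine ⟨lintegral_lt_top_of_le (M := L) fun t ht => supNorm_le fun x hx => ?_,
    lintegral_lt_top_of_le (M := N * Real.exp (L * T)) fun t ht => supNorm_le fun x hx => ?_,
    lintegral_lt_top_of_le (M := M) fun t ht => supNorm_le fun x _ => hb t ht x⟩
  · have hch := hsol.chars hn hβ₁ hβ₂ ht.1 ht.2 C (fun s hs => hc s (hsub ht hs))
      (fun s hs => hb s (hsub ht hs))
    have := norm_deriv_le_of_lipschitz (x₀ := x) (hch.vel.lipschitzWith t)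
    rw [Real.coe_toNNReal _ hch.vel.L_nonneg] at this
    rw [hsol.deriv_velocity_eq C ht (hc t ht) hx]
    simpa only [clampTime_of_mem (⟨ht.1, le_rfl⟩ : t ∈ Icc 0 t), Real.norm_eq_abs] using this
  · have hch := hsol.chars hn hβ₁ hβ₂ ht.1 ht.2 C (fun s hs => hc s (hsub ht hs))
      (fun s hs => hb s (hsub ht hs))
    rw [← Real.norm_eq_abs]
    refine norm_deriv_le_of_lip' (mul_nonneg hρ.nonneg (Real.exp_pos _).le)
      (Eventually.of_forall fun y => ?_)
    obtain ⟨a, rfl⟩ := hch.vel.surjective_flow t x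
    obtain ⟨b, rfl⟩ := hch.vel.surjective_flow t y
    rw [hch.rho t ⟨ht.1, le_rfl⟩, hch.rho t ⟨ht.1, le_rfl⟩, Real.norm_eq_abs, Real.norm_eq_abs,
      mul_assoc]
    refine (hρ.lip b a).trans (mul_le_mul_of_nonneg_left ?_ hρ.nonneg)
    refine (hch.vel.abs_sub_le_flow t b a).trans (mul_le_mul_of_nonneg_right ?_ (abs_nonneg _))
    rw [abs_of_nonneg ht.1]
    exact Real.exp_le_exp.2 (mul_le_mul_of_nonneg_left ht.2.le hch.vel.L_nonneg)

end Solution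

end HouLuoModel

/-! ### Continuation past T -/

namespace HouLuoModel

/-- Joint continuity and the compactness of [0, 1] make the convergence uniform in x. -/
lemma tendsto_iSup_enorm_sub {g : ℝ → ℝ → ℝ} (hg : Continuous fun p : ℝ × ℝ => g p.1 p.2)
    (t : ℝ) :
    Tendsto (fun s => ⨆ x ∈ Ioo (0 : ℝ) 1, ‖g s x - g t x‖ₑ) (𝓝 t) (𝓝 0) := by
  rw [ENNReal.tendsto_nhds_zero]
  intro ε hε
  have h := (isCompact_Icc (a := (0 : ℝ)) (b := 1)).eventually_forall_of_forall_eventually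
    (x₀ := t) (P := fun s x => ‖g s x - g t x‖ₑ < ε) fun x _ => by
      have hc : Continuous fun p : ℝ × ℝ => ‖g p.1 p.2 - g t p.2‖ₑ :=
        (hg.sub ((hg.comp (Continuous.prodMk_right t)).comp continuous_snd)).enorm
      exact hc.continuousAt.eventually_lt continuousAt_const (by simpa using hε)
  filter_upwards [h] with s hs
  exact iSup₂_le fun x hx => (hs x (Ioo_subset_Icc_self hx)).le

/-- A jointly smooth function with supports in `[c,1)` belongs to `C([0,T), K^n)`. -/
lemma contK_of_jointC {n : ℕ} {T c : ℝ} (hc : 0 < c) {f : ℝ → ℝ → ℝ} (hf : JointC n f)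
    (hs : ∀ t ∈ Ico 0 T, tsupport (f t) ⊆ Ico c 1) : ContK n T f where
  mem t ht := ⟨hf.contDiff t, isCompact_Icc.of_isClosed_subset (isClosed_tsupport _)
    ((hs t ht).trans Ico_subset_Icc_self), (hs t ht).trans fun _ hx => ⟨hc.trans_le hx.1, hx.2⟩⟩
  cont t ht := by
    simp only [cNorm]
    have key : ∀ k ∈ Finset.range (n + 1), Tendsto (fun s => ⨆ x ∈ Ioo (0 : ℝ) 1,
        ‖iteratedDeriv k (fun x => f s x - f t x) x‖ₑ) (𝓝[Ico 0 T] t) (𝓝 0) := by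
      intro k hk
      have hk' : k ≤ n := Nat.lt_succ_iff.1 (Finset.mem_range.1 hk)
      refine ((tendsto_iSup_enorm_sub (g := fun s => iteratedDeriv k (f s)) (hf.continuous_iteratedDeriv hk') t).mono_left
        nhdsWithin_le_nhds).congr fun s => ?_
      have h1 : ∀ r x, ContDiffAt ℝ k (f r) x := fun r x =>
        ((hf.contDiff r).of_le (by exact_mod_cast hk')).contDiffAt
      exact iSup_congr fun x => iSup_congr fun _ => by
        rw [iteratedDeriv_fun_sub (h1 s x) (h1 t x)]
    simpa using tendsto_finsetSum _ key
  bdd S hS := by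
    have hB : ∀ k ∈ Finset.range (n + 1), ∃ B : ℝ, ∀ t ∈ Icc 0 S, ∀ x ∈ Ioo (0 : ℝ) 1,
        ‖iteratedDeriv k (f t) x‖ ≤ B := by
      intro k hk
      obtain ⟨B, hB⟩ := ((isCompact_Icc (a := (0 : ℝ)) (b := S)).prod
        (isCompact_Icc (a := (0 : ℝ)) (b := 1))).exists_bound_of_continuousOn
        (hf.continuous_iteratedDeriv (Nat.lt_succ_iff.1 (Finset.mem_range.1 hk))).continuousOn
      exact ⟨B, fun t ht x hx => hB (t, x) ⟨ht, Ioo_subset_Icc_self hx⟩⟩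
    choose! B hB using hB
    have hle : ∀ t ∈ Icc 0 S, kNorm n (f t) ≤
        (∑ k ∈ Finset.range (n + 1), ENNReal.ofReal (B k)) + (ENNReal.ofReal c)⁻¹ := by
      intro t ht
      refine add_le_add (Finset.sum_le_sum fun k hk => iSup₂_le fun x hx => ?_)
        (ENNReal.inv_le_inv.2 (le_iInf₂ fun x hx =>
          ENNReal.ofReal_le_ofReal (hs t ⟨ht.1, ht.2.trans_lt hS⟩ hx).1))
      rw [← ofReal_norm]
      exact ENNReal.ofReal_le_ofReal (hB k hk t ht x hx)
    refine (iSup₂_le hle).trans_lt (ENNReal.add_lt_top.2 ⟨?_, ?_⟩)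
    · exact ENNReal.sum_lt_top.2 fun _ _ => ENNReal.ofReal_lt_top
    · exact ENNReal.inv_lt_top.2 (ENNReal.ofReal_pos.2 hc)

section Transport

variable {β₁ β₂ : ℝ} {n : ℕ} {c M T₁ : ℝ} {w : ℝ → ℝ → ℝ} {f g : ℝ → ℝ}

/-- Solutions of the truncated Lagrangian system are as smooth as their data. -/
lemma Cutoff.jointC_of_fixedPoint (C : Cutoff c) (hβ₁ : 0 ≤ β₁) (hβ₂ : 0 ≤ β₂) (hw : Adm M w)
    (hf : ContDiff ℝ n f) (hg : ContDiff ℝ n g)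
    (hfix : ∀ t z, w t z = C.transport (fun t => C.vel β₁ β₂ (w t)) f g (clampTime T₁ t) z)
    {k : ℕ} (hk : k ≤ n) : JointC k w := by
  induction k with
  | zero => exact hw.cont
  | succ k ih =>
    -- Order k of w gives order k + 1 of its velocity, hence of the flow and of the transported
    -- data, which by the fixed-point equation is w again.
    have h := (C.jointC_transport (C.isVelocity hβ₁ hβ₂ hw)
      (C.jointC_vel (β₁ := β₁) (β₂ := β₂) (ih (by omega)))
      (hf.of_le (by exact_mod_cast hk)) (hg.of_le (by exact_mod_cast hk))).comp_time
      (continuous_clampTime T₁)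
    have hwe : w = fun t z => C.transport (fun t => C.vel β₁ β₂ (w t)) f g (clampTime T₁ t) z :=
      funext fun t => funext fun z => hfix t z
    rw [hwe]
    exact h

/-- A solution of the truncated Lagrangian system whose supports stay where the truncation is
inactive is a solution of the original system. -/
lemma Cutoff.isSolution_of_fixedPoint (C : Cutoff c) (hc : 0 < c) (hβ₁ : 0 ≤ β₁) (hβ₂ : 0 ≤ β₂)
    (hn : 1 ≤ n) (hw : Adm M w) (hf : ContDiff ℝ n f) (hg : ContDiff ℝ n g)
    (hfix : ∀ t z, w t z = C.transport (fun t => C.vel β₁ β₂ (w t)) f g (clampTime T₁ t) z)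
    {r : ℝ → ℝ → ℝ}
    (hr : ∀ t z, r t z = g (flowInv (fun t => C.vel β₁ β₂ (w t)) (clampTime T₁ t) z))
    {T : ℝ} (hT : T ≤ T₁) (hs : ∀ t ∈ Ico 0 T, suppU w r t ⊆ Ico c 1) :
    IsSolution β₁ β₂ n T w r := by
  set u := fun t => C.vel β₁ β₂ (w t) with hu_def
  have hu : IsVelocity _ _ u := C.isVelocity hβ₁ hβ₂ hw
  have hwJ : JointC n w := C.jointC_of_fixedPoint hβ₁ hβ₂ hw hf hg hfix le_rfl
  have hrJ : JointC n r := by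
    have hre : r = fun t z => g (flowInv u (clampTime T₁ t) z) :=
      funext fun t => funext fun z => hr t z
    rw [hre]
    exact (JointC.contDiff_comp hg (hu.jointC_flowInv
      (C.jointC_vel (β₁ := β₁) (β₂ := β₂) hwJ).of_succ)).comp_time (continuous_clampTime T₁)
  have hclamp : ∀ t ∈ Ico 0 T, clampTime T₁ t = t := fun t ht =>
    clampTime_of_mem ⟨ht.1, ht.2.le.trans hT⟩
  have hzero : ∀ t ∈ Ico 0 T, ∀ y, y ∉ Icc c 1 → w t y = 0 ∧ r t y = 0 := fun t ht y hy =>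
    eq_zero_of_notMem_suppU fun h => hy (Ico_subset_Icc_self (hs t ht h))
  have hvel : ∀ t ∈ Ico 0 T, ∀ x ∈ Ioo (0 : ℝ) 1, u t x = velocity β₁ β₂ (w t) x :=
    fun t ht x hx => C.vel_eq_velocity (hwJ.contDiff t).continuous
      (fun y hy => (hzero t ht y hy).1) β₁ β₂ (Ioo_subset_Icc_self hx)
  -- The argument of `chars_of_velocity` in reverse: the derivative along the orbit through (t, x)
  -- is known, and subtracting the variation in x yields the time derivative at fixed x.
  have along : ∀ {h : ℝ → ℝ → ℝ}, JointC n h → ∀ t ∈ Ico 0 T, ∀ x ∈ Ioo (0 : ℝ) 1, ∀ d,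
      HasDerivWithinAt (fun s => h s (flow u s (flowInv u t x))) d (Ico 0 T) t →
      HasDerivWithinAt (fun s => h s x) (d - velocity β₁ β₂ (w t) x * deriv (h t) x)
        (Ico 0 T) t := by
    intro h hh t ht x hx d hd
    have hc' : Continuous fun p : ℝ × ℝ => deriv (h p.1) p.2 := by
      simpa using hh.continuous_iteratedDeriv hn
    have h1 := hasDerivWithinAt_sub_frozen (I := Ico 0 T) (f := h) (f' := fun s => deriv (h s))
      (γ := fun s => flow u s (flowInv u t x)) (t₀ := t) (v := u t x)
      (fun s _ y => ((hh.contDiff s).differentiable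
        (by exact_mod_cast (by omega : n ≠ 0)) y).hasDerivAt)
      hc'.continuousWithinAt
      (by simpa only [hu.flow_flowInv] using
        (hu.hasDerivAt_flow t (flowInv u t x)).hasDerivWithinAt)
    simp only [hu.flow_flowInv, hvel t ht x hx] at h1
    refine ((hd.sub h1).congr_deriv (by ring)).congr_of_mem (fun s _ => ?_) ht
    simp
  refine ⟨contK_of_jointC hc hwJ fun t ht => subset_union_left.trans (hs t ht),
    contK_of_jointC hc hrJ fun t ht => subset_union_right.trans (hs t ht),
    fun t ht x hx => ?_, fun t ht x hx => ?_⟩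
  · have hIc : Continuous fun s => C.χ (flow u s (flowInv u t x)) :=
      C.continuous_χ.comp (hu.continuous_flow.comp (Continuous.prodMk_left _))
    refine along hwJ t ht x hx _ ?_
    have h1 := (((hIc.integral_hasStrictDerivAt 0 t).hasDerivAt.const_mul
      (g (flowInv u t x))).const_add (f (flowInv u t x))).hasDerivWithinAt (s := Ico 0 T)
    refine (h1.congr_deriv ?_).congr_of_mem (fun s hs' => ?_) ht
    · rw [hu.flow_flowInv, ← C.χ_mul_eq (w := r t) fun y hy => (hzero t ht y hy).2, hr,
        hclamp t ht, mul_comm]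
    · rw [hfix, hclamp s hs', Cutoff.transport, hu.flowInv_flow]
  · have := along hrJ t ht x hx 0 ?_
    · simpa using this
    refine (hasDerivWithinAt_const t (Ico 0 T) (g (flowInv u t x))).congr_of_mem
      (fun s hs' => ?_) ht
    rw [hr, hclamp s hs', hu.flowInv_flow]

end Transport

lemma isSolution_zero (β₁ β₂ : ℝ) (n : ℕ) (T : ℝ) :
    IsSolution β₁ β₂ n T (fun _ _ => 0) (fun _ _ => 0) := by
  have h : ContK n T (fun _ _ => 0) := contK_of_jointC one_pos (JointC.const n 0) fun t _ => by
    simp [tsupport_eq_empty_iff.2 (show (fun _ : ℝ => (0 : ℝ)) = 0 from rfl)]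
  refine ⟨h, h, fun t _ x _ => ?_, fun t _ x _ => ?_⟩ <;>
    simpa using hasDerivWithinAt_const t (Ico 0 T) (0 : ℝ)

section Solution

variable {β₁ β₂ : ℝ} {n : ℕ} {T : ℝ} {ω ρ : ℝ → ℝ → ℝ}

lemma Chars.eq_transport {S L B c : ℝ} {C : Cutoff c} {u : ℝ → ℝ → ℝ}
    (h : Chars β₁ β₂ S L B C u ω ρ) {t : ℝ} (ht : t ∈ Icc 0 S) (z : ℝ) :
    ω t z = C.transport u (ω 0) (ρ 0) t z := by
  rw [Cutoff.transport, ← h.omega t ht, h.vel.flow_flowInv]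

lemma Chars.eq_comp_flowInv {S L B c : ℝ} {C : Cutoff c} {u : ℝ → ℝ → ℝ}
    (h : Chars β₁ β₂ S L B C u ω ρ) {t : ℝ} (ht : t ∈ Icc 0 S) (z : ℝ) :
    ρ t z = ρ 0 (flowInv u t z) := by
  rw [← h.rho t ht, h.vel.flow_flowInv]

lemma IsSolution.canBeContinued_of_empty (hsol : IsSolution β₁ β₂ n T ω ρ) (hn : 1 ≤ n)
    (hβ₁ : 0 ≤ β₁) (hβ₂ : 0 ≤ β₂) (h0 : suppU ω ρ 0 = ∅) : CanBeContinued β₁ β₂ n T ω ρ := by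
  refine ⟨T + 1, by linarith, fun _ _ => 0, fun _ _ => 0, isSolution_zero _ _ _ _, fun t ht => ?_⟩
  have h := hsol.suppU_eq_empty hn hβ₁ hβ₂ h0 ht
  have hz : ∀ x, ω t x = 0 ∧ ρ t x = 0 := fun x => eq_zero_of_notMem_suppU (by rw [h]; simp)
  exact ⟨funext fun x => (hz x).1.symm, funext fun x => (hz x).2.symm⟩

/-- A solution whose supports stay away from `0` and from `1` can be continued. -/
lemma IsSolution.canBeContinued (hsol : IsSolution β₁ β₂ n T ω ρ) (hn : 1 ≤ n)
    (hβ₁ : 0 ≤ β₁) (hβ₂ : 0 ≤ β₂) (hT : 0 < T) (hbelow : SuppBddBelow T ω ρ)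
    (habove : StaysBelowOne T ω ρ) : CanBeContinued β₁ β₂ n T ω ρ := by
  rcases (suppU ω ρ 0).eq_empty_or_nonempty with h0 | h0
  · exact hsol.canBeContinued_of_empty hn hβ₁ hβ₂ h0
  have hcpt := hsol.isCompact_suppU (t := 0) ⟨le_rfl, hT⟩
  obtain ⟨q, hq⟩ := hcpt.exists_isLeast h0
  obtain ⟨p, hp⟩ := hcpt.exists_isGreatest h0
  obtain ⟨c₀, hc₀, hsupp₀⟩ := hbelow
  obtain ⟨b, hb, hsuppb⟩ := habove
  -- Halving c₀ leaves room below the supports: they may move a little past c₀ after time T while χ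
  -- is still exactly 1/x on them.
  set c := c₀ / 2 with hc_def
  have hc : 0 < c := half_pos hc₀
  have hsupp : ∀ t ∈ Ico 0 T, suppU ω ρ t ⊆ Ici c := fun t ht =>
    (hsupp₀ t ht).trans (Ici_subset_Ici.2 (half_le_self hc₀.le))
  obtain ⟨C⟩ := nonempty_cutoff hc
  have hω0 := hsol.contK_omega.mem 0 ⟨le_rfl, hT⟩
  have hρ0 := hsol.contK_rho.mem 0 ⟨le_rfl, hT⟩
  obtain ⟨N₁, hN₁⟩ := hω0.exists_bddLip hn
  obtain ⟨N₂, hN₂⟩ := hρ0.exists_bddLip hn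
  set N := max N₁ N₂ with hN
  have hωN := hN₁.mono (le_max_left N₁ N₂)
  have hρN := hN₂.mono (le_max_right N₁ N₂)
  set T₁ := T + 1 with hT₁
  -- The longer time T₁ is used in M so that one bound serves both the truncated solution on [0, T₁]
  -- and ω on [0, T), as uniqueness requires.
  set M := N + N * (C.K * T₁) with hM
  obtain ⟨w, hw, hfix⟩ := C.exists_fixedPoint hβ₁ hβ₂ (T := T₁) (by linarith) hM.symm.le hωN hρN
  set u := fun t => C.vel β₁ β₂ (w t) with hu_def
  have hu : IsVelocity _ _ u := C.isVelocity hβ₁ hβ₂ hw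
  set r : ℝ → ℝ → ℝ := fun t z => ρ 0 (flowInv u (clampTime T₁ t) z) with hr
  have hsub : ∀ {t}, t ∈ Ico 0 T → Icc 0 t ⊆ Ico 0 T := fun ht s hs =>
    ⟨hs.1, hs.2.trans_lt ht.2⟩
  have hwω : ∀ t ∈ Ico 0 T, w t = ω t := by
    intro t ht
    funext z
    have hbd : ∀ s ∈ Icc 0 t, ∀ x, |ω s x| ≤ M := fun s hs x =>
      (hsol.abs_omega_le hn hβ₁ hβ₂ C hsupp hωN hρN (hsub ht hs) x).trans (by
        have : N * (C.K * T) ≤ N * (C.K * T₁) := mul_le_mul_of_nonneg_left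
          (mul_le_mul_of_nonneg_left (by linarith) C.K_pos.le) hωN.nonneg
        linarith)
    have hch := hsol.chars hn hβ₁ hβ₂ ht.1 ht.2 C (fun s hs => hsupp s (hsub ht hs)) hbd
    have h := C.eq_of_fixedPoint hβ₁ hβ₂ hωN hρN (S := t) hw (hsol.adm ht.1 ht.2 hbd)
      (fun s hs x => by
        rw [hfix, clampTime_of_mem ⟨hs.1, hs.2.trans (ht.2.le.trans (by linarith))⟩])
      (fun s hs x => by
        rw [← hch.eq_transport hs x, clampTime_of_mem hs])
      (t := t) ⟨ht.1, le_rfl⟩ z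
    rwa [clampTime_of_mem (⟨ht.1, le_rfl⟩ : t ∈ Icc 0 t)] at h
  have hchar : ∀ t ∈ Ico 0 T, Chars β₁ β₂ t _ _ C u ω ρ := fun t ht =>
    hsol.chars_of_velocity hn ht.2 C (fun s hs => hsupp s (hsub ht hs)) hu fun s hs x hx => by
      simp only [hu_def, hwω s (hsub ht hs)]
      exact hsol.vel_eq C (hsub ht hs) (hsupp s (hsub ht hs)) hx
  have hrρ : ∀ t ∈ Ico 0 T, r t = ρ t := fun t ht => funext fun z => by
    rw [(hchar t ht).eq_comp_flowInv ⟨ht.1, le_rfl⟩ z]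
    simp only [hr]
    rw [clampTime_of_mem ⟨ht.1, ht.2.le.trans (by linarith)⟩]
  have hsuppw : ∀ t ∈ Icc 0 T₁, suppU w r t = flow u t '' suppU ω ρ 0 := by
    intro t ht
    refine tsupport_union_eq_image (J := fun x => ∫ s in (0 : ℝ)..t, C.χ (flow u s x))
      (hu.flowHomeo t) (fun x => ?_) (fun x => ?_)
    · change r t (flow u t x) = _
      simp only [hr, clampTime_of_mem ht, hu.flowInv_flow]
    · change w t (flow u t x) = _
      rw [hfix, clampTime_of_mem ht, Cutoff.transport, hu.flowInv_flow]
  have hXc : ∀ x, Continuous fun t => flow u t x := fun x =>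
    hu.continuous_flow.comp (Continuous.prodMk_left x)
  have hev : ∀ᶠ t in 𝓝[<] T, t ∈ Ico 0 T := by
    filter_upwards [Ioo_mem_nhdsLT hT] with t ht using Ioo_subset_Ico_self ht
  have hlow : ∀ t ∈ Ico 0 T, c₀ ≤ flow u t q := fun t ht =>
    hsupp₀ t ht ((hchar t ht).isLeast hq ⟨ht.1, le_rfl⟩).1
  have hupp : ∀ t ∈ Ico 0 T, flow u t p ≤ b := fun t ht =>
    hsuppb t ht ((hchar t ht).isGreatest hp ⟨ht.1, le_rfl⟩).1
  -- The flow of the truncated solution is defined beyond T, so the bounds on the extreme orbits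
  -- pass to T by continuity, and the strict inequalities c < c₀ and b < 1 survive for a short time.
  have hlowT : c₀ ≤ flow u T q := ge_of_tendsto
    ((hXc q).continuousAt.tendsto.mono_left nhdsWithin_le_nhds) (hev.mono hlow)
  have huppT : flow u T p ≤ b := le_of_tendsto
    ((hXc p).continuousAt.tendsto.mono_left nhdsWithin_le_nhds) (hev.mono hupp)
  have hnear : ∀ᶠ t in 𝓝 T, c < flow u t q ∧ flow u t p < 1 :=
    ((hXc q).continuousAt.eventually_const_lt ((half_lt_self hc₀).trans_le hlowT)).and
      ((hXc p).continuousAt.eventually_lt_const (huppT.trans_lt hb))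
  obtain ⟨ε, hε, hball⟩ := Metric.eventually_nhds_iff.1 hnear
  set T' := T + min ε 1 with hT'
  have hmin : 0 < min ε 1 := lt_min hε one_pos
  have hT'1 : T' ≤ T₁ := by simp only [hT', hT₁]; linarith [min_le_right ε 1]
  have hends : ∀ t ∈ Ico 0 T', c < flow u t q ∧ flow u t p < 1 := by
    intro t ht
    rcases lt_or_ge t T with h | h
    · exact ⟨(half_lt_self hc₀).trans_le (hlow t ⟨ht.1, h⟩), (hupp t ⟨ht.1, h⟩).trans_lt hb⟩
    · refine hball ?_
      rw [Real.dist_eq, abs_of_nonneg (sub_nonneg.2 h)]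
      have := ht.2
      simp only [hT'] at this
      linarith [min_le_left ε 1]
  refine ⟨T', by linarith, w, r, C.isSolution_of_fixedPoint hc hβ₁ hβ₂ hn hw hω0.1 hρ0.1 hfix
    (fun _ _ => rfl) hT'1 fun t ht => ?_, fun t ht => ⟨hwω t ht, hrρ t ht⟩⟩
  rw [hsuppw t ⟨ht.1, ht.2.le.trans hT'1⟩]
  rintro _ ⟨x, hx, rfl⟩
  have hmono := (hu.strictMono_flow t).monotone
  exact ⟨(hends t ht).1.le.trans (hmono (hq.2 hx)), (hmono (hp.2 hx)).trans_lt (hends t ht).2⟩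

/-- For the longer solution, [0, T] is a compact subinterval of its lifetime, on which the K^n norm
is bounded. -/
lemma IsSolution.suppBddBelow_of_canBeContinued (h : CanBeContinued β₁ β₂ n T ω ρ) :
    SuppBddBelow T ω ρ := by
  obtain ⟨T', hT', ω', ρ', hsol', heq⟩ := h
  obtain ⟨c, hc, hsupp⟩ := hsol'.exists_lower_bound hT'
  refine ⟨c, hc, fun t ht => ?_⟩
  have := hsupp t (Ico_subset_Icc_self ht)
  rwa [suppU, (heq t ht).1, (heq t ht).2] at this

/-- The K^n norm does not measure the distance to 1, so compactness is applied to the orbit of the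
greatest point instead: it attains its maximum over [0, T], and every value of it lies in a support
contained in (0, 1). -/
lemma IsSolution.staysBelowOne_of_canBeContinued (hn : 1 ≤ n) (hβ₁ : 0 ≤ β₁) (hβ₂ : 0 ≤ β₂)
    (hT : 0 < T) (h : CanBeContinued β₁ β₂ n T ω ρ) : StaysBelowOne T ω ρ := by
  obtain ⟨T', hT', ω', ρ', hsol', heq⟩ := h
  suffices hb : ∃ b < (1 : ℝ), ∀ t ∈ Ico 0 T, suppU ω' ρ' t ⊆ Iic b by
    obtain ⟨b, hb, hsupp⟩ := hb
    refine ⟨b, hb, fun t ht => ?_⟩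
    have := hsupp t ht
    rwa [suppU, (heq t ht).1, (heq t ht).2] at this
  have h0T : (0 : ℝ) ∈ Ico 0 T' := ⟨le_rfl, hT.trans hT'⟩
  rcases (suppU ω' ρ' 0).eq_empty_or_nonempty with h0 | h0
  · refine ⟨0, one_pos, fun t ht => ?_⟩
    rw [hsol'.suppU_eq_empty hn hβ₁ hβ₂ h0 ⟨ht.1, ht.2.trans hT'⟩]
    exact empty_subset _
  · obtain ⟨p, hp⟩ := (hsol'.isCompact_suppU h0T).exists_isGreatest h0
    obtain ⟨c, -, C, L, B, u, -, hch⟩ := hsol'.exists_chars hn hβ₁ hβ₂ hT.le hT'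
    obtain ⟨s, hs, hmax⟩ := isCompact_Icc.exists_isMaxOn (nonempty_Icc.2 hT.le)
      (hch.vel.continuous_flow.comp (Continuous.prodMk_left p)).continuousOn
    refine ⟨flow u s p, (hsol'.suppU_subset ⟨hs.1, hs.2.trans_lt hT'⟩
      (hch.isGreatest hp hs).1).2, fun t ht x hx => ?_⟩
    have ht' := Ico_subset_Icc_self ht
    exact ((hch.isGreatest hp ht').2 hx).trans (hmax ht')

end Solution

end HouLuoModel

/-! ### Assembling the equivalences -/

theorem proposition2p2 (β₁ β₂ : ℝ) (hβ₂ : 0 < β₂) (hβ₂' : β₂ ≤ 1) (hβ₁ : 1 ≤ β₁)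
    (n : ℕ) (hn : 1 ≤ n) (T : ℝ) (hT : 0 < T) (ω ρ : ℝ → ℝ → ℝ)
    (hsol : HouLuoModel.IsSolution β₁ β₂ n T ω ρ) :
    -- under confinement away from the cut-off point `1`, the five conditions are equivalent
    (HouLuoModel.StaysBelowOne T ω ρ →
      List.TFAE [
        HouLuoModel.CanBeContinued β₁ β₂ n T ω ρ,
        (∫⁻ t in Ioo 0 T,
          HouLuoModel.supNorm (deriv (HouLuoModel.velocity β₁ β₂ (ω t)))) < ∞,
        (∫⁻ t in Ioo 0 T, HouLuoModel.supNorm (deriv (ρ t))) < ∞,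
        (∫⁻ t in Ioo 0 T, HouLuoModel.supNorm (ω t)) < ∞,
        0 < liminf (HouLuoModel.delta ω ρ) (𝓝[<] T)]) ∧
    -- the last four are equivalent without it
    List.TFAE [
      (∫⁻ t in Ioo 0 T,
        HouLuoModel.supNorm (deriv (HouLuoModel.velocity β₁ β₂ (ω t)))) < ∞,
      (∫⁻ t in Ioo 0 T, HouLuoModel.supNorm (deriv (ρ t))) < ∞,
      (∫⁻ t in Ioo 0 T, HouLuoModel.supNorm (ω t)) < ∞,
      0 < liminf (HouLuoModel.delta ω ρ) (𝓝[<] T)] ∧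
    -- and confinement is necessary for continuation
    (HouLuoModel.CanBeContinued β₁ β₂ n T ω ρ → HouLuoModel.StaysBelowOne T ω ρ) := by
  have hβ₁0 : 0 ≤ β₁ := zero_le_one.trans hβ₁
  have hβ₂0 : 0 ≤ β₂ := hβ₂.le
  have hiff := hsol.suppBddBelow_iff hT
  have hbounds := fun h => hsol.lintegrals_of_suppBddBelow hn hβ₁0 hβ₂0 hT (hiff.2 h)
  have hfour : List.TFAE [
      (∫⁻ t in Ioo 0 T,
        HouLuoModel.supNorm (deriv (HouLuoModel.velocity β₁ β₂ (ω t)))) < ∞,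
      (∫⁻ t in Ioo 0 T, HouLuoModel.supNorm (deriv (ρ t))) < ∞,
      (∫⁻ t in Ioo 0 T, HouLuoModel.supNorm (ω t)) < ∞,
      0 < liminf (HouLuoModel.delta ω ρ) (𝓝[<] T)] := by
    tfae_have 1 → 4 := fun h => hiff.1 (hsol.suppBddBelow_of_velocity hn hβ₁0 hβ₂0 hT h)
    tfae_have 2 → 3 := hsol.lintegral_omega_of_rho hn hβ₁0 hβ₂0 hT
    tfae_have 3 → 4 := fun h => hiff.1 (hsol.suppBddBelow_of_omega hn hβ₁0 hβ₂0 hT h)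
    tfae_have 4 → 1 := fun h => (hbounds h).1
    tfae_have 4 → 2 := fun h => (hbounds h).2.1
    tfae_finish
  refine ⟨fun hstay => ?_, hfour,
    HouLuoModel.IsSolution.staysBelowOne_of_canBeContinued hn hβ₁0 hβ₂0 hT⟩
  tfae_have 1 → 5 := fun h => hiff.1 (HouLuoModel.IsSolution.suppBddBelow_of_canBeContinued h)
  tfae_have 5 → 1 := fun h => hsol.canBeContinued hn hβ₁0 hβ₂0 hT (hiff.2 h) hstay
  tfae_have 2 ↔ 5 := hfour.out 0 3
  tfae_have 3 ↔ 5 := hfour.out 1 3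
  tfae_have 4 ↔ 5 := hfour.out 2 3
  tfae_finish
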